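/- Let $(M^3,\bar g)$ be a smooth Lorentzian $3$-manifold (signature $(+,+,-)$, Levi-Civita connection $\nabla$) and let $f:\Sigma\to M^3$ be a mixed type surface, i.e. a smooth immersion of a connected smooth $2$-manifold $\Sigma$ whose first fundamental form $ds^2=f^*\bar g$ is positive definite at some point and indefinite at some point. A point of $\Sigma$ is called spacelike, timelike or lightlike if $ds^2$ is there positive definite, indefinite or degenerate, respectively. In local coordinates $(u,v)$ put $ds^2=E\,du^2+2F\,du\,dv+G\,dv^2$ and $\lambda=EG-F^2$; a lightlike point $p$ is non-degenerate if $d\lambda(p)\neq 0$. Away from the lightlike points let $K$ be the Gaussian curvature of $ds^2$ and let $S=(df)^{-1}\circ(-\nabla\nu)$ be the shape operator of $f$ with respect to a local unit normal vector field $\nu$ (so $|\bar g(\nu,\nu)|=1$); a non-lightlike point is umbilic if $S$ is there a real multiple of the identity, and the principal curvatures are said to be real valued at a point if $S$ is there diagonalizable over $\mathbb{R}$. Let $p\in\Sigma$ be a non-degenerate lightlike point, and suppose that $K$ is bounded on $U'\setminus\{\text{lightlike points}\}$ for some neighbourhood $U'$ of $p$. Then $p$ is not an accumulation point of the set of umbilic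 points of $f$. Moreover, there is an open neighbourhood $U$ of $p$ such that the principal curvatures are real valued at every timelike point of $U$. -/

import Mathlib

open Set Filter Topology
open scoped Manifold ContDiff Bundle

noncomputable section

/-- A smooth Lorentzian metric, of signature `(+, +, -)`, on a smooth `3`-manifold. -/
structure LorentzianMetric (M : Type*) [TopologicalSpace M]
    [ChartedSpace (EuclideanSpace ℝ (Fin 3)) M] [IsManifold (𝓡 3) ∞ M] where
  /-- The scalar product on each tangent space. -/
  inner (x : M) : TangentSpace (𝓡 3) x →L[ℝ] TangentSpace (𝓡 3) x →L[ℝ] ℝ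
  symm (x : M) (v w : TangentSpace (𝓡 3) x) : inner x v w = inner x w v
  exists_orthonormal (x : M) : ∃ b : Module.Basis (Fin 3) ℝ (TangentSpace (𝓡 3) x),
    ∀ i j, inner x (b i) (b j) = if i = j then (if i = 2 then -1 else 1) else 0
  contMDiff : ContMDiff (𝓡 3)
    ((𝓡 3).prod 𝓘(ℝ, EuclideanSpace ℝ (Fin 3) →L[ℝ] EuclideanSpace ℝ (Fin 3) →L[ℝ] ℝ)) ∞
    (fun x ↦ Bundle.TotalSpace.mk'
      (EuclideanSpace ℝ (Fin 3) →L[ℝ] EuclideanSpace ℝ (Fin 3) →L[ℝ] ℝ)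
      (E := fun x : M ↦ TangentSpace (𝓡 3) x →L[ℝ] TangentSpace (𝓡 3) x →L[ℝ] ℝ)
      x (inner x))

section LocalFormulas

/-! ### Classical formulas for a metric given by its coefficient matrix in coordinates -/

/-- The `i`-th partial derivative of a real function on `ℝⁿ`. -/
def partialDeriv {n : ℕ} (i : Fin n) (h : EuclideanSpace ℝ (Fin n) → ℝ)
    (x : EuclideanSpace ℝ (Fin n)) : ℝ :=
  fderiv ℝ h x (EuclideanSpace.single i 1)

/-- The Christoffel symbol `Γᵏᵢⱼ` of the Levi-Civita connection of the (pseudo-Riemannian) metric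
with coefficient matrix `G`. -/
def christoffel {n : ℕ} (G : EuclideanSpace ℝ (Fin n) → Matrix (Fin n) (Fin n) ℝ)
    (k i j : Fin n) (x : EuclideanSpace ℝ (Fin n)) : ℝ :=
  (1 / 2) * ∑ l, (G x)⁻¹ k l * (partialDeriv i (fun y ↦ G y j l) x
    + partialDeriv j (fun y ↦ G y i l) x - partialDeriv l (fun y ↦ G y i j) x)

/-- The component `Rˡᵢⱼₖ` of the curvature tensor, `R(∂ᵢ, ∂ⱼ)∂ₖ = ∑ₗ Rˡᵢⱼₖ ∂ₗ`, where
`R(X, Y)Z = ∇_X ∇_Y Z - ∇_Y ∇_X Z - ∇_{[X,Y]} Z`. -/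
def riemannCurvature {n : ℕ} (G : EuclideanSpace ℝ (Fin n) → Matrix (Fin n) (Fin n) ℝ)
    (l i j k : Fin n) (x : EuclideanSpace ℝ (Fin n)) : ℝ :=
  partialDeriv i (christoffel G l j k) x - partialDeriv j (christoffel G l i k) x
    + ∑ m, (christoffel G l i m x * christoffel G m j k x
      - christoffel G l j m x * christoffel G m i k x)

/-- The Gaussian curvature `⟨R(∂₁, ∂₂)∂₂, ∂₁⟩ / (EG - F²)` of a two-dimensional (definite or
indefinite) metric with coefficient matrix `G`, at a point where `G` is nondegenerate. -/
def gaussCurvatureOfCoeff (G : EuclideanSpace ℝ (Fin 2) → Matrix (Fin 2) (Fin 2) ℝ)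
    (x : EuclideanSpace ℝ (Fin 2)) : ℝ :=
  (∑ l, riemannCurvature G l 0 1 1 x * G x l 0) / (G x).det

end LocalFormulas

section Charts

variable {E : Type*} [NormedAddCommGroup E] [NormedSpace ℝ E]
  {N : Type*} [TopologicalSpace N] [ChartedSpace E N]

/-- The differential at `x` of a chart `e` of a manifold modelled on `E`. -/
def chartDeriv (e : OpenPartialHomeomorph N E) (x : N) : TangentSpace 𝓘(ℝ, E) x →L[ℝ] E :=
  mfderiv 𝓘(ℝ, E) 𝓘(ℝ, E) e x

/-- The differential at `y` of the inverse of a chart `e` of a manifold modelled on `E`. -/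
def chartSymmDeriv (e : OpenPartialHomeomorph N E) (y : E) :
    E →L[ℝ] TangentSpace 𝓘(ℝ, E) (e.symm y) :=
  mfderiv 𝓘(ℝ, E) 𝓘(ℝ, E) e.symm y

end Charts

section Surfaces

variable {S : Type*} [TopologicalSpace S] [ChartedSpace (EuclideanSpace ℝ (Fin 2)) S]
  [IsManifold (𝓡 2) ∞ S]
  {M : Type*} [TopologicalSpace M] [ChartedSpace (EuclideanSpace ℝ (Fin 3)) M]
  [IsManifold (𝓡 3) ∞ M]

/-- The coordinate vector `∂ᵢ` of the chart `e`, at the point with coordinates `x`. -/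
def coordVec {n : ℕ} {N : Type*} [TopologicalSpace N] [ChartedSpace (EuclideanSpace ℝ (Fin n)) N]
    (e : OpenPartialHomeomorph N (EuclideanSpace ℝ (Fin n))) (i : Fin n)
    (x : EuclideanSpace ℝ (Fin n)) : TangentSpace (𝓡 n) (e.symm x) :=
  chartSymmDeriv e x (EuclideanSpace.single i (1 : ℝ))

/-- The first fundamental form `ds²(v, w) = ⟨df(v), df(w)⟩` of `f` at `q`. -/
def firstFF (g : LorentzianMetric M) (f : S → M) (q : S) (v w : TangentSpace (𝓡 2) q) : ℝ :=
  g.inner (f q) (mfderiv (𝓡 2) (𝓡 3) f q v) (mfderiv (𝓡 2) (𝓡 3) f q w)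

/-- `q` is a spacelike point: `ds²` is positive definite at `q`. -/
def IsSpacelikePt (g : LorentzianMetric M) (f : S → M) (q : S) : Prop :=
  ∀ v : TangentSpace (𝓡 2) q, v ≠ 0 → 0 < firstFF g f q v v

/-- `q` is a timelike point: `ds²` is indefinite at `q`. -/
def IsTimelikePt (g : LorentzianMetric M) (f : S → M) (q : S) : Prop :=
  (∃ v : TangentSpace (𝓡 2) q, 0 < firstFF g f q v v) ∧
    ∃ w : TangentSpace (𝓡 2) q, firstFF g f q w w < 0

/-- `q` is a lightlike point: `ds²` is degenerate at `q`. -/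
def IsLightlikePt (g : LorentzianMetric M) (f : S → M) (q : S) : Prop :=
  ∃ v : TangentSpace (𝓡 2) q, v ≠ 0 ∧ ∀ w : TangentSpace (𝓡 2) q, firstFF g f q v w = 0

/-- `f` is a mixed type surface: a smooth immersion with spacelike and timelike points. -/
structure IsMixedTypeSurface (g : LorentzianMetric M) (f : S → M) : Prop where
  contMDiff : ContMDiff (𝓡 2) (𝓡 3) ∞ f
  injective_mfderiv : ∀ q, Function.Injective (mfderiv (𝓡 2) (𝓡 3) f q)
  exists_spacelike : ∃ q, IsSpacelikePt g f q
  exists_timelike : ∃ q, IsTimelikePt g f q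

/-- The coefficient matrix `!![E, F; F, G]` of `ds²` in the local coordinates `e = (u, v)`. -/
def firstFFCoeff (g : LorentzianMetric M) (f : S → M)
    (e : OpenPartialHomeomorph S (EuclideanSpace ℝ (Fin 2))) (x : EuclideanSpace ℝ (Fin 2)) :
    Matrix (Fin 2) (Fin 2) ℝ :=
  Matrix.of fun i j ↦ firstFF g f (e.symm x) (coordVec e i x) (coordVec e j x)

/-- The discriminant function `λ = EG - F²` in the local coordinates `e`. -/
def discriminant (g : LorentzianMetric M) (f : S → M)
    (e : OpenPartialHomeomorph S (EuclideanSpace ℝ (Fin 2))) (x : EuclideanSpace ℝ (Fin 2)) : ℝ :=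
  (firstFFCoeff g f e x).det

/-- `p` is a non-degenerate lightlike point: `p` is lightlike and `dλ(p) ≠ 0`, where `λ` is the
discriminant function in the local coordinates `e` around `p`. (On change of coordinates `λ` is
multiplied by the square of the Jacobian, so the condition does not depend on `e`.) -/
def IsNondegenerateLightlikePt (g : LorentzianMetric M) (f : S → M)
    (e : OpenPartialHomeomorph S (EuclideanSpace ℝ (Fin 2))) (p : S) : Prop :=
  IsLightlikePt g f p ∧ fderiv ℝ (discriminant g f e) (e p) ≠ 0

/-- The Gaussian curvature `K` of `ds²` at a point `q` that is not lightlike, computed in the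
local coordinates `e` around `q` (its value does not depend on `e`). -/
def gaussCurvature (g : LorentzianMetric M) (f : S → M)
    (e : OpenPartialHomeomorph S (EuclideanSpace ℝ (Fin 2))) (q : S) : ℝ :=
  gaussCurvatureOfCoeff (firstFFCoeff g f e) (e q)

/-- The coefficient matrix of the ambient metric in the local coordinates `φ`. -/
def metricCoeff (g : LorentzianMetric M)
    (φ : OpenPartialHomeomorph M (EuclideanSpace ℝ (Fin 3))) (y : EuclideanSpace ℝ (Fin 3)) :
    Matrix (Fin 3) (Fin 3) ℝ :=
  Matrix.of fun i j ↦ g.inner (φ.symm y) (coordVec φ i y) (coordVec φ j y)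

/-- The component vector, in the local coordinates `φ`, of a tangent vector of `M`. -/
def components (φ : OpenPartialHomeomorph M (EuclideanSpace ℝ (Fin 3))) (x : M)
    (v : TangentSpace (𝓡 3) x) : EuclideanSpace ℝ (Fin 3) :=
  chartDeriv φ x v

/-- The directional derivative `v(h)` of a real function `h` on the surface. -/
def dirDeriv (h : S → ℝ) (q : S) (v : TangentSpace (𝓡 2) q) : ℝ :=
  mfderiv (𝓡 2) 𝓘(ℝ, ℝ) h q v

/-- The `k`-th component, in the local coordinates `φ` around `f q`, of the covariant derivative
`∇_v X` at `q` of a vector field `X` along `f : S → M`, for the Levi-Civita connection `∇` of `g`: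
`(∇_v X)ᵏ = v(Xᵏ) + ∑ᵢⱼ Γᵏᵢⱼ df(v)ⁱ Xʲ`. -/
def covDerivComponent (g : LorentzianMetric M) (f : S → M)
    (φ : OpenPartialHomeomorph M (EuclideanSpace ℝ (Fin 3)))
    (X : ∀ q : S, TangentSpace (𝓡 3) (f q)) (q : S) (v : TangentSpace (𝓡 2) q) (k : Fin 3) : ℝ :=
  dirDeriv (fun q' ↦ components φ (f q') (X q') k) q v
    + ∑ i, ∑ j, christoffel (metricCoeff g φ) k i j (φ (f q))
        * components φ (f q) (mfderiv (𝓡 2) (𝓡 3) f q v) i * components φ (f q) (X q) j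

/-- The covariant derivative `∇_v X = ∑ₖ (∇_v X)ᵏ ∂ₖ` at `q` of a vector field `X` along `f`
(its value does not depend on the local coordinates `φ` around `f q`). -/
def covDerivAlong (g : LorentzianMetric M) (f : S → M)
    (φ : OpenPartialHomeomorph M (EuclideanSpace ℝ (Fin 3)))
    (X : ∀ q : S, TangentSpace (𝓡 3) (f q)) (q : S) (v : TangentSpace (𝓡 2) q) :
    TangentSpace (𝓡 3) (f q) :=
  ∑ k, covDerivComponent g f φ X q v k
    • (coordVec φ k (φ (f q)) : EuclideanSpace ℝ (Fin 3))

/-- `ν` is a smooth unit normal vector field of `f` on the set `W`. -/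
structure IsUnitNormalOn (g : LorentzianMetric M) (f : S → M)
    (ν : ∀ q : S, TangentSpace (𝓡 3) (f q)) (W : Set S) : Prop where
  contMDiffOn : ContMDiffOn (𝓡 2) (𝓡 3).tangent ∞
    (fun q ↦ (⟨f q, ν q⟩ : TangentBundle (𝓡 3) M)) W
  normal : ∀ q ∈ W, ∀ v : TangentSpace (𝓡 2) q,
    g.inner (f q) (ν q) (mfderiv (𝓡 2) (𝓡 3) f q v) = 0
  unit : ∀ q ∈ W, |g.inner (f q) (ν q) (ν q)| = 1

/-- `A = (df)⁻¹ ∘ (-∇ν)` is the shape operator of `f` at the point `q`, which is not lightlike,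
for some unit normal vector field `ν` near `q`. (`A` is determined up to sign, since `ν` is.)
The covariant derivative is computed in the local coordinates `φ` around `f q`. -/
def IsShapeOperator (g : LorentzianMetric M) (f : S → M)
    (φ : OpenPartialHomeomorph M (EuclideanSpace ℝ (Fin 3))) (q : S)
    (A : TangentSpace (𝓡 2) q →ₗ[ℝ] TangentSpace (𝓡 2) q) : Prop :=
  f q ∈ φ.source ∧ ¬ IsLightlikePt g f q ∧
    ∃ (ν : ∀ q' : S, TangentSpace (𝓡 3) (f q')) (W : Set S), IsOpen W ∧ q ∈ W ∧
      IsUnitNormalOn g f ν W ∧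
      ∀ v : TangentSpace (𝓡 2) q,
        mfderiv (𝓡 2) (𝓡 3) f q (A v) = -covDerivAlong g f φ ν q v

/-- `q` is an umbilic point: the shape operator at `q` is a real multiple of the identity. -/
def IsUmbilicPt (g : LorentzianMetric M) (f : S → M)
    (φ : OpenPartialHomeomorph M (EuclideanSpace ℝ (Fin 3))) (q : S) : Prop :=
  ∃ A : TangentSpace (𝓡 2) q →ₗ[ℝ] TangentSpace (𝓡 2) q, IsShapeOperator g f φ q A ∧
    ∃ k : ℝ, ∀ v, A v = k • v

/-- The principal curvatures at `q` are real valued: the shape operator at `q` is diagonalizable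
over `ℝ`, with eigenvalues the principal curvatures `k 0` and `k 1`. -/
def HasRealPrincipalCurvatures (g : LorentzianMetric M) (f : S → M)
    (φ : OpenPartialHomeomorph M (EuclideanSpace ℝ (Fin 3))) (q : S) : Prop :=
  ∃ A : TangentSpace (𝓡 2) q →ₗ[ℝ] TangentSpace (𝓡 2) q, IsShapeOperator g f φ q A ∧
    ∃ (b : Module.Basis (Fin 2) ℝ (TangentSpace (𝓡 2) q)) (k : Fin 2 → ℝ),
      ∀ i, A (b i) = k i • b i

end Surfaces

end

/-!
Near `p` everything is computed in the coordinates `e` of the surface and `φ` of the ambient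
manifold. Write `I` for the matrix of the first fundamental form, `λ = det I`, `[ij, l]` for its
Christoffel symbols of the first kind (which have no denominators), `F` for the surface in
coordinates, `n = ∂₁F × ∂₂F` for its normal covector and `hᵢⱼ = n(∇ᵢ∂ⱼF)`. All of these are smooth
across the lightlike points, and so is the discriminant `D = tr(adj I · h)² - 4 λ det h`
(`umbilicDiscriminant`).

*Shape operators.* Off the lightlike points the covector `⟨ν, ·⟩` of a unit normal is `c n` with
`c ≠ 0`, so the Weingarten equations read `Aᵀ I = c h`
(`IsShapeOperator.exists_matrix`) and give `(tr² A - 4 det A) λ² = c² D`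
(`discriminant_mul_det_sq`). If `D > 0`, then `A` has two distinct real eigenvalues: the point is not
umbilic and the principal curvatures are real. As `D` is continuous, it is enough to show `D(p) > 0`.

*Bounded curvature.* Clearing denominators gives `K λ² = B` with `B` smooth
(`gaussCurvatureOfCoeff_mul_det_sq`). As `K` is bounded and `dλ(p) ≠ 0`, it follows that `B(p) = 0`.
At `p` one has `adj I = m ξξᵀ` for a null vector `ξ` and some `m ≠ 0`. There `B` is `-m` times the
determinant of the form `q = [··, ξ]`, and `∂ₐλ = 2m [aξ, ξ]`. If `q(ξ, ξ)` vanished, the singular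
form `q` would have `ξ` in its kernel and `dλ(p)` would be zero; so `[ξξ, ξ] ≠ 0`
(`christoffelFirst_null_ne_zero`).

*Conclusion.* At `p` the covector `⟨dF(ξ), ·⟩` annihilates the tangent plane, so it is a multiple of
`n`, and `[ξξ, ξ] = ⟨dF(ξ), ∇_ξ dF(ξ)⟩` is the same multiple of `h(ξ, ξ)`. Hence `h(ξ, ξ) ≠ 0` and
`D(p) = (m h(ξ, ξ))² > 0` (`umbilicDiscriminant_pos`).

The existence of a shape operator at the nearby timelike points comes from an explicit unit normal
field (`exists_isUnitNormalOn`, `exists_isShapeOperator`).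
-/

noncomputable section

/-! ### Calculus of partial derivatives and of matrix-valued functions -/

section PartialDerivatives

variable {n m : ℕ} {x : EuclideanSpace ℝ (Fin n)} {i j : Fin n}
  {h h' : EuclideanSpace ℝ (Fin n) → ℝ}

theorem partialDeriv_add (hh : DifferentiableAt ℝ h x) (hh' : DifferentiableAt ℝ h' x) :
    partialDeriv i (fun y ↦ h y + h' y) x = partialDeriv i h x + partialDeriv i h' x := by
  simp [partialDeriv, fderiv_fun_add hh hh']

theorem partialDeriv_mul (hh : DifferentiableAt ℝ h x) (hh' : DifferentiableAt ℝ h' x) :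
    partialDeriv i (fun y ↦ h y * h' y) x
      = partialDeriv i h x * h' x + h x * partialDeriv i h' x := by
  simp [partialDeriv, fderiv_fun_mul hh hh']
  ring

theorem partialDeriv_sum {ι : Type*} {s : Finset ι} {u : ι → EuclideanSpace ℝ (Fin n) → ℝ}
    (hu : ∀ k ∈ s, DifferentiableAt ℝ (u k) x) :
    partialDeriv i (fun y ↦ ∑ k ∈ s, u k y) x = ∑ k ∈ s, partialDeriv i (u k) x := by
  simp [partialDeriv, fderiv_fun_sum hu]

theorem Filter.EventuallyEq.partialDeriv_eq (hh : h =ᶠ[𝓝 x] h') :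
    partialDeriv i h x = partialDeriv i h' x := by
  simp [partialDeriv, hh.fderiv_eq]

theorem fderiv_apply_eq_sum_partialDeriv (v : EuclideanSpace ℝ (Fin n)) :
    fderiv ℝ h x v = ∑ a, v a * partialDeriv a h x := by
  conv_lhs => rw [← (EuclideanSpace.basisFun (Fin n) ℝ).sum_repr v]
  simp [partialDeriv, map_sum]

theorem fderiv_eq_zero_of_partialDeriv (hh : ∀ a, partialDeriv a h x = 0) :
    fderiv ℝ h x = 0 := by
  ext v
  simp [fderiv_apply_eq_sum_partialDeriv, hh]

theorem partialDeriv_comp {F : EuclideanSpace ℝ (Fin n) → EuclideanSpace ℝ (Fin m)}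
    {u : EuclideanSpace ℝ (Fin m) → ℝ} (hu : DifferentiableAt ℝ u (F x))
    (hF : DifferentiableAt ℝ F x) :
    partialDeriv i (fun y ↦ u (F y)) x
      = ∑ a, partialDeriv i (fun y ↦ F y a) x * partialDeriv a u (F x) := by
  have h1 : fderiv ℝ (fun y ↦ u (F y)) x = (fderiv ℝ u (F x)).comp (fderiv ℝ F x) :=
    fderiv_comp x hu hF
  rw [partialDeriv, h1, ContinuousLinearMap.comp_apply, fderiv_apply_eq_sum_partialDeriv]
  refine Finset.sum_congr rfl fun a _ ↦ ?_
  have h2 : HasFDerivAt (fun y ↦ F y a)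
      ((EuclideanSpace.proj a : _ →L[ℝ] ℝ).comp (fderiv ℝ F x)) x :=
    (EuclideanSpace.proj a : EuclideanSpace ℝ (Fin m) →L[ℝ] ℝ).hasFDerivAt.comp x hF.hasFDerivAt
  simp [partialDeriv, h2.fderiv]

theorem ContDiffAt.partialDeriv (hh : ContDiffAt ℝ ∞ h x) :
    ContDiffAt ℝ ∞ (partialDeriv i h) x :=
  (hh.fderiv_right (m := ∞) (by simp)).clm_apply contDiffAt_const

theorem ContDiffAt.partialDeriv_comm (hh : ContDiffAt ℝ ∞ h x) :
    _root_.partialDeriv i (_root_.partialDeriv j h) x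
      = _root_.partialDeriv j (_root_.partialDeriv i h) x := by
  have hs : IsSymmSndFDerivAt ℝ h x := hh.isSymmSndFDerivAt (by simpa using ENat.LEInfty.out)
  have hd : DifferentiableAt ℝ (fderiv ℝ h) x :=
    (hh.fderiv_right (m := ∞) (by simp)).differentiableAt (by simp)
  have key : ∀ i j : Fin n, _root_.partialDeriv i (_root_.partialDeriv j h) x
      = fderiv ℝ (fderiv ℝ h) x (EuclideanSpace.single i 1) (EuclideanSpace.single j 1) := by
    intro i j
    have : HasFDerivAt (_root_.partialDeriv j h) _ x :=
      hd.hasFDerivAt.clm_apply (hasFDerivAt_const (EuclideanSpace.single j (1 : ℝ)) x)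
    rw [_root_.partialDeriv, this.fderiv]
    simp
  rw [key, key, hs]

end PartialDerivatives

section MatrixSmoothness

variable {E : Type*} [NormedAddCommGroup E] [NormedSpace ℝ E] {n : ℕ}
  {G : E → Matrix (Fin n) (Fin n) ℝ} {x : E}

theorem ContDiffAt.matrix_det (hG : ∀ i j, ContDiffAt ℝ ∞ (fun y ↦ G y i j) x) :
    ContDiffAt ℝ ∞ (fun y ↦ (G y).det) x := by
  simp only [Matrix.det_apply']
  exact ContDiffAt.sum fun σ _ ↦ contDiffAt_const.mul (contDiffAt_prod fun i _ ↦ hG _ _)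

theorem ContDiffAt.matrix_adjugate (hG : ∀ i j, ContDiffAt ℝ ∞ (fun y ↦ G y i j) x)
    (i j : Fin n) : ContDiffAt ℝ ∞ (fun y ↦ (G y).adjugate i j) x := by
  simp only [Matrix.adjugate_apply]
  refine ContDiffAt.matrix_det fun a b ↦ ?_
  simp only [Matrix.updateRow_apply]
  split_ifs
  · exact contDiffAt_const
  · exact hG a b

theorem ContDiffAt.matrix_inv (hG : ∀ i j, ContDiffAt ℝ ∞ (fun y ↦ G y i j) x)
    (hx : (G x).det ≠ 0) (i j : Fin n) : ContDiffAt ℝ ∞ (fun y ↦ (G y)⁻¹ i j) x := by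
  simp only [Matrix.inv_def, Ring.inverse_eq_inv', Matrix.smul_apply, smul_eq_mul]
  exact ((ContDiffAt.matrix_det hG).inv hx).mul (ContDiffAt.matrix_adjugate hG i j)

end MatrixSmoothness

/-! ### Christoffel symbols of the first kind -/

section FirstKind

variable {n : ℕ} {G : EuclideanSpace ℝ (Fin n) → Matrix (Fin n) (Fin n) ℝ}
  {x : EuclideanSpace ℝ (Fin n)}

/-- The Christoffel symbol of the first kind `[ij, l] = ⟨∇_∂ᵢ ∂ⱼ, ∂ₗ⟩` of the metric with
coefficient matrix `G`. Unlike `christoffel` it is meaningful where `G` is degenerate. -/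
def christoffelFirst (G : EuclideanSpace ℝ (Fin n) → Matrix (Fin n) (Fin n) ℝ)
    (i j l : Fin n) (x : EuclideanSpace ℝ (Fin n)) : ℝ :=
  (1 / 2) * (partialDeriv i (fun y ↦ G y j l) x
    + partialDeriv j (fun y ↦ G y i l) x - partialDeriv l (fun y ↦ G y i j) x)

theorem christoffel_eq_sum (k i j : Fin n) :
    christoffel G k i j x = ∑ l, (G x)⁻¹ k l * christoffelFirst G i j l x := by
  simp only [christoffel, christoffelFirst, Finset.mul_sum]
  exact Finset.sum_congr rfl fun l _ ↦ by ring

theorem partialDeriv_coeff_symm (hs : ∀ᶠ y in 𝓝 x, (G y).IsSymm) (i j l : Fin n) :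
    partialDeriv i (fun y ↦ G y j l) x = partialDeriv i (fun y ↦ G y l j) x :=
  EventuallyEq.partialDeriv_eq (hs.mono fun _ hy ↦ hy.apply l j)

theorem christoffelFirst_comm (hs : ∀ᶠ y in 𝓝 x, (G y).IsSymm) (i j l : Fin n) :
    christoffelFirst G i j l x = christoffelFirst G j i l x := by
  simp only [christoffelFirst, partialDeriv_coeff_symm hs l i j]
  ring

theorem christoffel_comm (hs : ∀ᶠ y in 𝓝 x, (G y).IsSymm) (k i j : Fin n) :
    christoffel G k i j x = christoffel G k j i x := by
  simp only [christoffel_eq_sum, christoffelFirst_comm hs i j]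

/-- Compatibility of the Levi-Civita connection with the metric, on coordinate fields. -/
theorem partialDeriv_coeff_eq (hs : ∀ᶠ y in 𝓝 x, (G y).IsSymm) (i j l : Fin n) :
    partialDeriv i (fun y ↦ G y j l) x
      = christoffelFirst G i j l x + christoffelFirst G i l j x := by
  simp only [christoffelFirst, partialDeriv_coeff_symm hs i l j, partialDeriv_coeff_symm hs l i j,
    partialDeriv_coeff_symm hs j i l]
  ring

theorem sum_coeff_mul_christoffel (hs : (G x).IsSymm) (hx : (G x).det ≠ 0) (i j l : Fin n) :
    ∑ k, G x k l * christoffel G k i j x = christoffelFirst G i j l x := by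
  have h1 : ∀ s, ∑ k, G x k l * (G x)⁻¹ k s = if l = s then 1 else 0 := by
    intro s
    have := congrFun (congrFun (Matrix.mul_nonsing_inv (G x) (Ne.isUnit hx)) l) s
    rw [Matrix.mul_apply, Matrix.one_apply] at this
    rw [← this]
    exact Finset.sum_congr rfl fun k _ ↦ by rw [hs.apply]
  simp only [christoffel_eq_sum, Finset.mul_sum]
  rw [Finset.sum_comm]
  simp only [← mul_assoc, ← Finset.sum_mul, h1]
  simp

theorem det_mul_christoffel (hx : (G x).det ≠ 0) (k i j : Fin n) :
    (G x).det * christoffel G k i j x = ∑ l, (G x).adjugate k l * christoffelFirst G i j l x := by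
  simp only [christoffel_eq_sum, Finset.mul_sum, Matrix.inv_def, Ring.inverse_eq_inv',
    Matrix.smul_apply, smul_eq_mul]
  exact Finset.sum_congr rfl fun l _ ↦ by field_simp

theorem ContDiffAt.christoffelFirst (hG : ∀ i j, ContDiffAt ℝ ∞ (fun y ↦ G y i j) x)
    (i j l : Fin n) : ContDiffAt ℝ ∞ (_root_.christoffelFirst G i j l) x :=
  contDiffAt_const.mul (((hG j l).partialDeriv.add (hG i l).partialDeriv).sub
    (hG i j).partialDeriv)

theorem ContDiffAt.christoffel (hG : ∀ i j, ContDiffAt ℝ ∞ (fun y ↦ G y i j) x)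
    (hx : (G x).det ≠ 0) (k i j : Fin n) :
    ContDiffAt ℝ ∞ (_root_.christoffel G k i j) x := by
  have : _root_.christoffel G k i j
      = fun y ↦ ∑ l, (G y)⁻¹ k l * _root_.christoffelFirst G i j l y :=
    funext fun y ↦ christoffel_eq_sum k i j
  rw [this]
  exact ContDiffAt.sum fun l _ ↦
    (ContDiffAt.matrix_inv hG hx k l).mul (ContDiffAt.christoffelFirst hG i j l)

end FirstKind

/-! ### The Gaussian curvature near a degenerate point of a plane metric -/

section GaussCurvature

variable {G : EuclideanSpace ℝ (Fin 2) → Matrix (Fin 2) (Fin 2) ℝ}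
  {x : EuclideanSpace ℝ (Fin 2)}

/-- The numerator of the Gaussian curvature, in the form `K = gaussNumerator / det²`. It is a
polynomial in the derivatives of order at most two of the coefficients. -/
def gaussNumerator (G : EuclideanSpace ℝ (Fin 2) → Matrix (Fin 2) (Fin 2) ℝ)
    (x : EuclideanSpace ℝ (Fin 2)) : ℝ :=
  (G x).det * (partialDeriv 0 (christoffelFirst G 1 1 0) x
      - partialDeriv 1 (christoffelFirst G 0 1 0) x)
    + ∑ l, ∑ s, (G x).adjugate l s * (christoffelFirst G 0 1 l x * christoffelFirst G 0 1 s x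
      - christoffelFirst G 0 0 l x * christoffelFirst G 1 1 s x)

theorem gaussCurvatureOfCoeff_mul_det_sq (hG : ∀ i j, ContDiffAt ℝ ∞ (fun y ↦ G y i j) x)
    (hs : ∀ y, (G y).IsSymm) (hx : (G x).det ≠ 0) :
    gaussCurvatureOfCoeff G x * (G x).det ^ 2 = gaussNumerator G x := by
  have hs' : ∀ᶠ y in 𝓝 x, (G y).IsSymm := Eventually.of_forall hs
  have hdet : ∀ᶠ y in 𝓝 x, (G y).det ≠ 0 :=
    (ContDiffAt.matrix_det hG).continuousAt.eventually_ne hx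
  -- differentiating `∑ₗ gₗ₀ Γˡⱼₖ = [jk, 0]` trades `∂Γ` for derivatives without denominators
  have hd : ∀ i j k, ∑ l, (partialDeriv i (fun y ↦ G y 0 l) x * christoffel G l j k x
      + G x 0 l * partialDeriv i (christoffel G l j k) x)
        = partialDeriv i (christoffelFirst G j k 0) x := by
    intro i j k
    have h1 : (fun y ↦ ∑ l, G y 0 l * christoffel G l j k y) =ᶠ[𝓝 x] christoffelFirst G j k 0 :=
      hdet.mono fun y hy ↦ (Finset.sum_congr rfl fun l _ ↦ by rw [(hs y).apply]).trans
        (sum_coeff_mul_christoffel (hs y) hy j k 0)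
    have hc : ∀ l, DifferentiableAt ℝ (christoffel G l j k) x := fun l ↦
      (ContDiffAt.christoffel hG hx l j k).differentiableAt (by simp)
    have hg : ∀ l, DifferentiableAt ℝ (fun y ↦ G y 0 l) x := fun l ↦
      (hG 0 l).differentiableAt (by simp)
    rw [← h1.partialDeriv_eq, partialDeriv_sum fun l _ ↦ (hg l).fun_mul (hc l)]
    exact Finset.sum_congr rfl fun l _ ↦ (partialDeriv_mul (hg l) (hc l)).symm
  have hc := det_mul_christoffel (G := G) hx
  have hl := sum_coeff_mul_christoffel (hs x) hx
  have e1 := hd 0 1 1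
  have e2 := hd 1 0 1
  simp only [partialDeriv_coeff_eq hs', Fin.sum_univ_two] at e1 e2
  simp only [Fin.sum_univ_two] at hc hl
  have hsym := (hs x).apply 0 1
  rw [gaussCurvatureOfCoeff, gaussNumerator]
  simp only [riemannCurvature, Fin.sum_univ_two]
  field_simp
  rw [← e1, ← e2]
  replace hl : ∀ i j, G x 0 0 * christoffel G 0 i j x + G x 0 1 * christoffel G 1 i j x
      = christoffelFirst G i j 0 x := fun i j ↦ by rw [← hsym]; exact hl i j 0
  simp only [hsym, christoffelFirst_comm hs' 1 0, christoffel_comm hs' _ 1 0] at hl ⊢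
  linear_combination (G x).det * (christoffel G 0 1 1 x * hl 0 0
    + christoffel G 1 1 1 x * hl 0 1 - christoffel G 0 0 1 x * hl 0 1
    - christoffel G 1 0 1 x * hl 1 1)
    - christoffelFirst G 0 0 0 x * hc 0 1 1 - christoffelFirst G 0 0 1 x * hc 1 1 1
    + christoffelFirst G 0 1 0 x * hc 0 0 1 + christoffelFirst G 0 1 1 x * hc 1 0 1

theorem ContDiffAt.gaussNumerator (hG : ∀ i j, ContDiffAt ℝ ∞ (fun y ↦ G y i j) x) :
    ContDiffAt ℝ ∞ (_root_.gaussNumerator G) x := by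
  have hc := ContDiffAt.christoffelFirst hG
  refine ((ContDiffAt.matrix_det hG).mul ((hc _ _ _).partialDeriv.sub
    (hc _ _ _).partialDeriv)).add ?_
  exact ContDiffAt.sum fun l _ ↦ ContDiffAt.sum fun s _ ↦
    (ContDiffAt.matrix_adjugate hG l s).mul
      (((hc _ _ _).mul (hc _ _ _)).sub ((hc _ _ _).mul (hc _ _ _)))

/-- If the numerator were nonzero at `x`, boundedness of `K = gaussNumerator / det²` would force
`det` to vanish on a neighbourhood of `x`. -/
theorem gaussNumerator_eq_zero (hG : ∀ᶠ y in 𝓝 x, ∀ i j, ContDiffAt ℝ ∞ (fun y ↦ G y i j) y)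
    (hs : ∀ y, (G y).IsSymm) (hx : (G x).det = 0)
    (hd : fderiv ℝ (fun y ↦ (G y).det) x ≠ 0) {C : ℝ}
    (hK : ∀ᶠ y in 𝓝 x, (G y).det ≠ 0 → |gaussCurvatureOfCoeff G y| ≤ C) :
    gaussNumerator G x = 0 := by
  by_contra hne
  have hcd : ContinuousAt (fun y ↦ (G y).det) x :=
    (ContDiffAt.matrix_det hG.self_of_nhds).continuousAt
  have hcont : ContinuousAt (fun y ↦ |gaussNumerator G y| - C * (G y).det ^ 2) x :=
    (ContDiffAt.gaussNumerator hG.self_of_nhds).continuousAt.abs.sub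
      (continuousAt_const.mul (hcd.pow 2))
  have hpos : ∀ᶠ y in 𝓝 x, 0 < |gaussNumerator G y| - C * (G y).det ^ 2 := by
    refine hcont.eventually (lt_mem_nhds ?_)
    simpa [hx] using hne
  refine hd ?_
  have : (fun y ↦ (G y).det) =ᶠ[𝓝 x] fun _ ↦ 0 := by
    filter_upwards [hpos, hG, hK] with y h1 h2 h3
    by_contra h4
    have h5 := gaussCurvatureOfCoeff_mul_det_sq h2 hs h4
    have h6 : |gaussNumerator G y| ≤ C * (G y).det ^ 2 := by
      rw [← h5, abs_mul, abs_of_nonneg (sq_nonneg (G y).det)]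
      exact mul_le_mul_of_nonneg_right (h3 h4) (sq_nonneg _)
    linarith
  rw [this.fderiv_eq]
  simp

/-- A symmetric matrix with null vector `ξ` is a multiple of the square of the covector
`(ξ₁, -ξ₀)`. Equivalently, its adjugate is `m ξξᵀ`. -/
theorem exists_coeff_of_null {A : Matrix (Fin 2) (Fin 2) ℝ} (hA : A.IsSymm) {ξ : Fin 2 → ℝ}
    (hξ : ξ ≠ 0) (hn : A.mulVec ξ = 0) :
    ∃ m : ℝ, A 0 0 = m * ξ 1 ^ 2 ∧ A 0 1 = -(m * (ξ 0 * ξ 1)) ∧ A 1 0 = -(m * (ξ 0 * ξ 1)) ∧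
      A 1 1 = m * ξ 0 ^ 2 := by
  have h0 := congrFun hn 0
  have h1 := congrFun hn 1
  have h01 := hA.apply 0 1
  simp only [Matrix.mulVec, dotProduct, Fin.sum_univ_two, Pi.zero_apply] at h0 h1
  rw [h01] at h1
  have hpos : ξ 0 ^ 2 + ξ 1 ^ 2 ≠ 0 := by
    intro h
    have a0 : ξ 0 = 0 := by nlinarith [sq_nonneg (ξ 0), sq_nonneg (ξ 1)]
    have a1 : ξ 1 = 0 := by nlinarith [sq_nonneg (ξ 0), sq_nonneg (ξ 1)]
    exact hξ (funext fun i ↦ by fin_cases i <;> simp [a0, a1])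
  refine ⟨(A 0 0 + A 1 1) / (ξ 0 ^ 2 + ξ 1 ^ 2), ?_, ?_, ?_, ?_⟩
  · field_simp
    linear_combination ξ 0 * h0 - ξ 1 * h1
  · field_simp
    linear_combination ξ 1 * h0 + ξ 0 * h1
  · rw [h01]
    field_simp
    linear_combination ξ 1 * h0 + ξ 0 * h1
  · field_simp
    linear_combination ξ 1 * h1 - ξ 0 * h0

/-- Where `adj G = m ξξᵀ`, Jacobi's formula for the derivative of the determinant reads
`∂ₐ(det G) = m (∂ₐG)(ξ, ξ) = 2m [aξ, ξ]`. -/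
theorem partialDeriv_det_of_coeff (hG : ∀ i j, ContDiffAt ℝ ∞ (fun y ↦ G y i j) x)
    (hs : ∀ y, (G y).IsSymm) {ξ : Fin 2 → ℝ} {m : ℝ} (h00 : G x 0 0 = m * ξ 1 ^ 2)
    (h01 : G x 0 1 = -(m * (ξ 0 * ξ 1))) (h10 : G x 1 0 = -(m * (ξ 0 * ξ 1)))
    (h11 : G x 1 1 = m * ξ 0 ^ 2) (a : Fin 2) :
    partialDeriv a (fun y ↦ (G y).det) x
      = 2 * m * ∑ j, ∑ l, ξ j * ξ l * christoffelFirst G a j l x := by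
  have hs' : ∀ᶠ y in 𝓝 x, (G y).IsSymm := Eventually.of_forall hs
  have hda : ∀ i j, DifferentiableAt ℝ (fun y ↦ G y i j) x := fun i j ↦
    (hG i j).differentiableAt (by simp)
  have e1 : (fun y ↦ (G y).det)
      = fun y ↦ G y 0 0 * G y 1 1 + (-1) * (G y 0 1 * G y 1 0) := by
    funext y
    rw [Matrix.det_fin_two]
    ring
  have hm1 : partialDeriv a (fun _ ↦ (-1 : ℝ)) x = 0 := by simp [partialDeriv]
  rw [e1, partialDeriv_add ((hda _ _).fun_mul (hda _ _))
    ((differentiableAt_const _).fun_mul ((hda _ _).fun_mul (hda _ _))),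
    partialDeriv_mul (hda _ _) (hda _ _),
    partialDeriv_mul (differentiableAt_const _) ((hda _ _).fun_mul (hda _ _)),
    partialDeriv_mul (hda _ _) (hda _ _), hm1]
  simp only [partialDeriv_coeff_eq hs', Fin.sum_univ_two, h00, h01, h10, h11]
  ring

/-- If the Gaussian curvature is bounded near a point `x` where the metric degenerates with
`d(det) ≠ 0`, the null direction `ξ` at `x` is transverse to the degeneracy locus, which is
expressed here as `[ξξ, ξ] ≠ 0`. Indeed the numerator of the curvature at `x` is a nonzero multiple
of the determinant of the quadratic form `[··, ξ]`; if that vanishes and `ξ` is isotropic for the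
form, then `ξ` is in its kernel, which means `d(det) = 0`. -/
theorem christoffelFirst_null_ne_zero (hG : ∀ᶠ y in 𝓝 x, ∀ i j, ContDiffAt ℝ ∞ (fun y ↦ G y i j) y)
    (hs : ∀ y, (G y).IsSymm) (hd : fderiv ℝ (fun y ↦ (G y).det) x ≠ 0) {ξ : Fin 2 → ℝ}
    (hξ : ξ ≠ 0) (hn : (G x).mulVec ξ = 0) {C : ℝ}
    (hK : ∀ᶠ y in 𝓝 x, (G y).det ≠ 0 → |gaussCurvatureOfCoeff G y| ≤ C) :
    ∑ i, ∑ j, ∑ l, ξ i * ξ j * ξ l * christoffelFirst G i j l x ≠ 0 := by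
  have hs' : ∀ᶠ y in 𝓝 x, (G y).IsSymm := Eventually.of_forall hs
  obtain ⟨m, h00, h01, h10, h11⟩ := exists_coeff_of_null (hs x) hξ hn
  have hx : (G x).det = 0 := by
    rw [Matrix.det_fin_two, h00, h01, h10, h11]
    ring
  have hB := gaussNumerator_eq_zero hG hs hx hd hK
  intro hnull
  refine hd (fderiv_eq_zero_of_partialDeriv fun a ↦ ?_)
  rw [partialDeriv_det_of_coeff hG.self_of_nhds hs h00 h01 h10 h11]
  rw [gaussNumerator, hx] at hB
  have c10 : ∀ l, christoffelFirst G 1 0 l x = christoffelFirst G 0 1 l x :=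
    fun l ↦ christoffelFirst_comm hs' 1 0 l
  simp only [Matrix.adjugate_fin_two, Fin.sum_univ_two, Matrix.of_apply, Matrix.cons_val_zero,
    Matrix.cons_val_one, Matrix.cons_val', Matrix.cons_val_fin_one, h00, h01, h10, h11, c10]
    at hB hnull ⊢
  set q00 := ξ 0 * christoffelFirst G 0 0 0 x + ξ 1 * christoffelFirst G 0 0 1 x with hq00
  set q01 := ξ 0 * christoffelFirst G 0 1 0 x + ξ 1 * christoffelFirst G 0 1 1 x with hq01
  set q11 := ξ 0 * christoffelFirst G 1 1 0 x + ξ 1 * christoffelFirst G 1 1 1 x with hq11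
  have hB' : m * (q01 ^ 2 - q00 * q11) = 0 := by
    rw [← hB, hq00, hq01, hq11]
    ring
  have hq : ξ 0 ^ 2 * q00 + 2 * ξ 0 * ξ 1 * q01 + ξ 1 ^ 2 * q11 = 0 := by
    rw [← hnull, hq00, hq01, hq11]
    ring
  rcases mul_eq_zero.1 hB' with hm | hq'
  · simp [hm]
  -- a singular symmetric form that vanishes on `ξ` has `ξ` in its kernel
  have k0 : (ξ 0 * q00 + ξ 1 * q01) ^ 2 = 0 := by
    linear_combination q00 * hq + ξ 1 ^ 2 * hq'
  have k1 : (ξ 0 * q01 + ξ 1 * q11) ^ 2 = 0 := by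
    linear_combination q11 * hq + ξ 0 ^ 2 * hq'
  have k0' := pow_eq_zero_iff (two_ne_zero) |>.1 k0
  have k1' := pow_eq_zero_iff (two_ne_zero) |>.1 k1
  fin_cases a
  · simp only [Fin.zero_eta]
    linear_combination 2 * m * k0'
  · simp only [Fin.mk_one, c10]
    linear_combination 2 * m * k1'

end GaussCurvature

/-! ### Vector fields along a map, in coordinates -/

section AlongMap

variable {n m : ℕ}

/-- The scalar product with Gram matrix `A`. -/
def pairing (A : Matrix (Fin m) (Fin m) ℝ) (v w : Fin m → ℝ) : ℝ :=
  ∑ k, ∑ l, A k l * v k * w l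

/-- The components of the coordinate vector field `∂F/∂xⱼ` along `F`. -/
def tangentCoord (F : EuclideanSpace ℝ (Fin n) → EuclideanSpace ℝ (Fin m)) (j : Fin n)
    (x : EuclideanSpace ℝ (Fin n)) (k : Fin m) : ℝ :=
  partialDeriv j (fun y ↦ F y k) x

/-- The components of the covariant derivative `∇_∂ᵢ V` of a vector field `V` along `F`, for the
Levi-Civita connection of the metric with coefficient matrix `G`. -/
def covDerivCoord (G : EuclideanSpace ℝ (Fin m) → Matrix (Fin m) (Fin m) ℝ)
    (F : EuclideanSpace ℝ (Fin n) → EuclideanSpace ℝ (Fin m))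
    (V : EuclideanSpace ℝ (Fin n) → Fin m → ℝ) (i : Fin n) (x : EuclideanSpace ℝ (Fin n))
    (k : Fin m) : ℝ :=
  partialDeriv i (fun y ↦ V y k) x
    + ∑ a, ∑ b, christoffel G k a b (F x) * tangentCoord F i x a * V x b

variable {A : Matrix (Fin m) (Fin m) ℝ} {v w : Fin m → ℝ}

theorem pairing_comm (hA : A.IsSymm) : pairing A v w = pairing A w v := by
  rw [pairing, pairing, Finset.sum_comm]
  refine Finset.sum_congr rfl fun k _ ↦ Finset.sum_congr rfl fun l _ ↦ ?_
  rw [hA.apply]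
  ring

theorem pairing_sum_smul_left {ι : Type*} (s : Finset ι) (c : ι → ℝ) (u : ι → Fin m → ℝ) :
    pairing A (fun k ↦ ∑ i ∈ s, c i * u i k) v = ∑ i ∈ s, c i * pairing A (u i) v := by
  simp only [pairing, Finset.mul_sum, Finset.sum_mul]
  rw [Finset.sum_comm (s := s)]
  refine Finset.sum_congr rfl fun k _ ↦ ?_
  rw [Finset.sum_comm]
  exact Finset.sum_congr rfl fun i _ ↦ Finset.sum_congr rfl fun l _ ↦ by ring

variable {G : EuclideanSpace ℝ (Fin m) → Matrix (Fin m) (Fin m) ℝ}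
  {F : EuclideanSpace ℝ (Fin n) → EuclideanSpace ℝ (Fin m)} {x : EuclideanSpace ℝ (Fin n)}
  {V W : EuclideanSpace ℝ (Fin n) → Fin m → ℝ}

/-- The Levi-Civita connection is metric: `∂ᵢ⟨V, W⟩ = ⟨∇ᵢV, W⟩ + ⟨V, ∇ᵢW⟩` along a map `F`. -/
theorem partialDeriv_pairing (hF : DifferentiableAt ℝ F x)
    (hG : ∀ k l, DifferentiableAt ℝ (fun z ↦ G z k l) (F x)) (hs : ∀ z, (G z).IsSymm)
    (hd : (G (F x)).det ≠ 0) (hV : ∀ k, DifferentiableAt ℝ (fun y ↦ V y k) x)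
    (hW : ∀ k, DifferentiableAt ℝ (fun y ↦ W y k) x) (i : Fin n) :
    partialDeriv i (fun y ↦ pairing (G (F y)) (V y) (W y)) x
      = pairing (G (F x)) (covDerivCoord G F V i x) (W x)
        + pairing (G (F x)) (V x) (covDerivCoord G F W i x) := by
  have hs' : ∀ᶠ z in 𝓝 (F x), (G z).IsSymm := Eventually.of_forall hs
  have hGF : ∀ k l, DifferentiableAt ℝ (fun y ↦ G (F y) k l) x := fun k l ↦
    DifferentiableAt.comp x (hG k l) hF
  have h1 : partialDeriv i (fun y ↦ pairing (G (F y)) (V y) (W y)) x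
      = ∑ k, ∑ l, ((∑ a, tangentCoord F i x a * (christoffelFirst G a k l (F x)
            + christoffelFirst G a l k (F x))) * V x k * W x l
          + G (F x) k l * partialDeriv i (fun y ↦ V y k) x * W x l
          + G (F x) k l * V x k * partialDeriv i (fun y ↦ W y l) x) := by
    unfold pairing
    rw [partialDeriv_sum fun k _ ↦ DifferentiableAt.fun_sum fun l _ ↦
      ((hGF k l).fun_mul (hV k)).fun_mul (hW l)]
    refine Finset.sum_congr rfl fun k _ ↦ ?_
    rw [partialDeriv_sum fun l _ ↦ ((hGF k l).fun_mul (hV k)).fun_mul (hW l)]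
    refine Finset.sum_congr rfl fun l _ ↦ ?_
    rw [partialDeriv_mul ((hGF k l).fun_mul (hV k)) (hW l), partialDeriv_mul (hGF k l) (hV k),
      partialDeriv_comp (hG k l) hF]
    simp only [partialDeriv_coeff_eq hs', tangentCoord]
    ring
  -- lowering the index of the Christoffel symbols
  have h2 : ∀ U U' : Fin m → ℝ, ∑ k, ∑ l, G (F x) k l
        * (∑ a, ∑ b, christoffel G k a b (F x) * tangentCoord F i x a * U b) * U' l
      = ∑ b, ∑ l, (∑ a, tangentCoord F i x a * christoffelFirst G a b l (F x)) * U b * U' l := by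
    intro U U'
    have : ∀ a b l, christoffelFirst G a b l (F x)
        = ∑ k, G (F x) k l * christoffel G k a b (F x) := fun a b l ↦
      (sum_coeff_mul_christoffel (hs _) hd a b l).symm
    simp only [this, Finset.mul_sum, Finset.sum_mul]
    rw [Finset.sum_comm]
    symm
    rw [Finset.sum_comm]
    symm
    refine Finset.sum_congr rfl fun l _ ↦ ?_
    calc _ = ∑ k, ∑ b, ∑ a, _ := Finset.sum_congr rfl fun k _ ↦ Finset.sum_comm
      _ = ∑ b, ∑ k, ∑ a, _ := Finset.sum_comm
      _ = ∑ b, ∑ a, ∑ k, _ := Finset.sum_congr rfl fun b _ ↦ Finset.sum_comm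
      _ = _ := Finset.sum_congr rfl fun b _ ↦ Finset.sum_congr rfl fun a _ ↦
        Finset.sum_congr rfl fun k _ ↦ by ring
  have h3 : pairing (G (F x)) (covDerivCoord G F V i x) (W x)
      = ∑ k, ∑ l, G (F x) k l * partialDeriv i (fun y ↦ V y k) x * W x l
        + ∑ b, ∑ l, (∑ a, tangentCoord F i x a * christoffelFirst G a b l (F x))
          * V x b * W x l := by
    rw [← h2]
    simp only [pairing, covDerivCoord, ← Finset.sum_add_distrib]
    exact Finset.sum_congr rfl fun k _ ↦ Finset.sum_congr rfl fun l _ ↦ by ring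
  have h4 : pairing (G (F x)) (V x) (covDerivCoord G F W i x)
      = ∑ k, ∑ l, G (F x) k l * V x k * partialDeriv i (fun y ↦ W y l) x
        + ∑ b, ∑ l, (∑ a, tangentCoord F i x a * christoffelFirst G a l b (F x))
          * V x b * W x l := by
    have : ∑ b, ∑ l, (∑ a, tangentCoord F i x a * christoffelFirst G a l b (F x))
          * V x b * W x l = ∑ b, ∑ l, (∑ a, tangentCoord F i x a
            * christoffelFirst G a b l (F x)) * W x b * V x l := by
      rw [Finset.sum_comm]
      exact Finset.sum_congr rfl fun k _ ↦ Finset.sum_congr rfl fun l _ ↦ by ring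
    rw [this, ← h2, pairing_comm (hs _)]
    rw [Finset.sum_comm (f := fun k l ↦ G (F x) k l * V x k * partialDeriv i (fun y ↦ W y l) x)]
    simp only [pairing, covDerivCoord, ← Finset.sum_add_distrib]
    exact Finset.sum_congr rfl fun k _ ↦ Finset.sum_congr rfl fun l _ ↦ by
      rw [(hs (F x)).apply k l]; ring
  rw [h1, h3, h4]
  simp only [← Finset.sum_add_distrib]
  refine Finset.sum_congr rfl fun k _ ↦ Finset.sum_congr rfl fun l _ ↦ ?_
  simp only [mul_add, Finset.sum_add_distrib, add_mul]
  ring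

theorem ContDiffAt.apply_coord (hF : ContDiffAt ℝ ∞ F x) (k : Fin m) :
    ContDiffAt ℝ ∞ (fun y ↦ F y k) x :=
  (EuclideanSpace.proj k : EuclideanSpace ℝ (Fin m) →L[ℝ] ℝ).contDiff.contDiffAt.comp x hF

theorem ContDiffAt.tangentCoord (hF : ContDiffAt ℝ ∞ F x) (j : Fin n) (k : Fin m) :
    ContDiffAt ℝ ∞ (fun y ↦ _root_.tangentCoord F j y k) x :=
  (hF.apply_coord k).partialDeriv

theorem covDerivCoord_tangentCoord_comm (hF : ContDiffAt ℝ ∞ F x) (hs : ∀ z, (G z).IsSymm)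
    (i j : Fin n) (k : Fin m) :
    covDerivCoord G F (tangentCoord F j) i x k = covDerivCoord G F (tangentCoord F i) j x k := by
  have h1 := (hF.apply_coord k).partialDeriv_comm (i := i) (j := j)
  simp only [covDerivCoord]
  congr 1
  rw [Finset.sum_comm]
  refine Finset.sum_congr rfl fun a _ ↦ Finset.sum_congr rfl fun b _ ↦ ?_
  rw [christoffel_comm (Eventually.of_forall hs)]
  ring

/-- The first kind Christoffel symbols of the metric induced by `F` are
`[ij, l] = ⟨∇ᵢ∂ⱼF, ∂ₗF⟩`. -/
theorem christoffelFirst_induced {I : EuclideanSpace ℝ (Fin n) → Matrix (Fin n) (Fin n) ℝ}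
    (hI : ∀ᶠ y in 𝓝 x, ∀ i j,
      I y i j = pairing (G (F y)) (tangentCoord F i y) (tangentCoord F j y))
    (hF : ContDiffAt ℝ ∞ F x)
    (hG : ∀ k l, DifferentiableAt ℝ (fun z ↦ G z k l) (F x)) (hs : ∀ z, (G z).IsSymm)
    (hd : (G (F x)).det ≠ 0) (i j l : Fin n) :
    christoffelFirst I i j l x
      = pairing (G (F x)) (covDerivCoord G F (tangentCoord F j) i x) (tangentCoord F l x) := by
  have ht : ∀ j k, DifferentiableAt ℝ (fun y ↦ tangentCoord F j y k) x := fun j k ↦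
    (hF.tangentCoord j k).differentiableAt (by simp)
  have h1 : ∀ i j l, partialDeriv i (fun y ↦ I y j l) x
      = pairing (G (F x)) (covDerivCoord G F (tangentCoord F j) i x) (tangentCoord F l x)
        + pairing (G (F x)) (covDerivCoord G F (tangentCoord F l) i x) (tangentCoord F j x) := by
    intro i j l
    rw [EventuallyEq.partialDeriv_eq (hI.mono fun y hy ↦ hy j l),
      partialDeriv_pairing (hF.differentiableAt (by simp)) hG hs hd (ht j) (ht l),
      pairing_comm (v := tangentCoord F j x) (hs _)]
  have h2 : ∀ i j, covDerivCoord G F (tangentCoord F j) i x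
      = covDerivCoord G F (tangentCoord F i) j x := fun i j ↦
    funext fun k ↦ covDerivCoord_tangentCoord_comm hF hs i j k
  rw [christoffelFirst, h1, h1, h1, h2 l i, h2 l j, h2 j i]
  ring

end AlongMap

/-! ### The normal covector and the umbilic discriminant of a surface in coordinates -/

section CrossProduct

/-- The components of the vector product of two vectors of `ℝ³`. -/
def cross (a b : Fin 3 → ℝ) : Fin 3 → ℝ :=
  ![a 1 * b 2 - a 2 * b 1, a 2 * b 0 - a 0 * b 2, a 0 * b 1 - a 1 * b 0]

theorem cross_ne_zero {a b : Fin 3 → ℝ} (h : LinearIndependent ℝ ![a, b]) : cross a b ≠ 0 := by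
  have := (crossProduct_ne_zero_iff_linearIndependent (v := a) (w := b)).2 h
  rwa [cross_apply] at this

theorem sum_mul_self_pos {u : Fin 3 → ℝ} (h : u ≠ 0) : 0 < ∑ k, u k * u k := by
  refine lt_of_le_of_ne (Finset.sum_nonneg fun k _ ↦ mul_self_nonneg _) fun h0 ↦ h ?_
  have := (Finset.sum_eq_zero_iff_of_nonneg fun k _ ↦ mul_self_nonneg (u k)).1 h0.symm
  exact funext fun k ↦ mul_self_eq_zero.1 (this k (Finset.mem_univ k))

theorem exists_eq_smul_cross {a b α : Fin 3 → ℝ} (h : cross a b ≠ 0)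
    (ha : ∑ k, α k * a k = 0) (hb : ∑ k, α k * b k = 0) :
    ∃ c : ℝ, ∀ k, α k = c * cross a b k := by
  have hpos := (sum_mul_self_pos h).ne'
  refine ⟨(∑ k, α k * cross a b k) / ∑ k, cross a b k * cross a b k, fun k ↦ ?_⟩
  rw [div_mul_eq_mul_div, eq_div_iff hpos]
  simp only [Fin.sum_univ_three] at ha hb
  fin_cases k <;>
    simp only [cross, Fin.sum_univ_three, Matrix.cons_val_zero, Matrix.cons_val_one,
      Matrix.cons_val, Fin.zero_eta, Fin.mk_one, Fin.reduceFinMk]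
  · linear_combination (b 1 * (a 0 * b 1 - a 1 * b 0) - b 2 * (a 2 * b 0 - a 0 * b 2)) * ha
      - (a 1 * (a 0 * b 1 - a 1 * b 0) - a 2 * (a 2 * b 0 - a 0 * b 2)) * hb
  · linear_combination (b 2 * (a 1 * b 2 - a 2 * b 1) - b 0 * (a 0 * b 1 - a 1 * b 0)) * ha
      - (a 2 * (a 1 * b 2 - a 2 * b 1) - a 0 * (a 0 * b 1 - a 1 * b 0)) * hb
  · linear_combination (b 0 * (a 2 * b 0 - a 0 * b 2) - b 1 * (a 1 * b 2 - a 2 * b 1)) * ha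
      - (a 0 * (a 2 * b 0 - a 0 * b 2) - a 1 * (a 1 * b 2 - a 2 * b 1)) * hb

theorem exists_eq_combination_of_cross {a b w : Fin 3 → ℝ} (h : cross a b ≠ 0)
    (hw : ∑ k, cross a b k * w k = 0) : ∃ s t : ℝ, ∀ k, w k = s * a k + t * b k := by
  have hpos := (sum_mul_self_pos h).ne'
  refine ⟨(∑ k, cross b (cross a b) k * w k) / ∑ k, cross a b k * cross a b k,
    (∑ k, cross (cross a b) a k * w k) / ∑ k, cross a b k * cross a b k, fun k ↦ ?_⟩
  rw [div_mul_eq_mul_div, div_mul_eq_mul_div, ← add_div, eq_div_iff hpos]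
  simp only [cross, Fin.sum_univ_three, Matrix.cons_val_zero, Matrix.cons_val_one,
      Matrix.cons_val] at hw ⊢
  fin_cases k <;>
    simp only [Fin.zero_eta, Fin.mk_one, Fin.reduceFinMk]
  · linear_combination (a 1 * b 2 - a 2 * b 1) * hw
  · linear_combination (a 2 * b 0 - a 0 * b 2) * hw
  · linear_combination (a 0 * b 1 - a 1 * b 0) * hw

theorem sum_cross_mul_left (a b : Fin 3 → ℝ) : ∑ k, cross a b k * a k = 0 := by
  simp [cross, Fin.sum_univ_three]
  ring

theorem sum_cross_mul_right (a b : Fin 3 → ℝ) : ∑ k, cross a b k * b k = 0 := by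
  simp [cross, Fin.sum_univ_three]
  ring

/-- The Cauchy–Binet formula for the Gram determinant of two vectors of a three-dimensional
space with scalar product of Gram matrix `A`. -/
theorem pairing_adjugate_cross {A : Matrix (Fin 3) (Fin 3) ℝ} (hA : A.IsSymm)
    (a b : Fin 3 → ℝ) :
    pairing A.adjugate (cross a b) (cross a b)
      = pairing A a a * pairing A b b - pairing A a b * pairing A b a := by
  have h1 := hA.apply 0 1
  have h2 := hA.apply 0 2
  have h3 := hA.apply 1 2
  simp only [pairing, cross, Fin.sum_univ_three, Matrix.adjugate_fin_three, Matrix.of_apply,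
    Matrix.cons_val', Matrix.cons_val_zero, Matrix.cons_val_one, Matrix.cons_val,
    Matrix.cons_val_fin_one, h1, h2, h3]
  ring

end CrossProduct

section Discriminant

/-- The discriminant of the second fundamental form `h` with respect to the first fundamental form
`I`. Where `det I ≠ 0` it is `(det I)²` times the discriminant of the characteristic polynomial of
`I⁻¹ h`, but it is defined and continuous also where `I` is degenerate. -/
def umbilicDiscriminant (I h : Matrix (Fin 2) (Fin 2) ℝ) : ℝ :=
  (I.adjugate * h).trace ^ 2 - 4 * I.det * h.det

/-- The operator `A` with `Aᵀ I = c h` has `tr A · det I = c tr(adj I · h)` and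
`det A · det I = c² det h`. -/
theorem discriminant_mul_det_sq {A I h : Matrix (Fin 2) (Fin 2) ℝ} {c : ℝ}
    (hI : I.IsSymm) (hA : A.transpose * I = c • h) :
    (A.trace ^ 2 - 4 * A.det) * I.det ^ 2 = c ^ 2 * umbilicDiscriminant I h := by
  have e : ∀ i j, A 0 i * I 0 j + A 1 i * I 1 j = c * h i j := fun i j ↦ by
    have := congrFun (congrFun hA i) j
    simpa [Matrix.mul_apply, Fin.sum_univ_two] using this
  have hs := hI.apply 0 1
  have t : A.trace * I.det = c * (I.adjugate * h).trace := by
    simp only [Matrix.trace_fin_two, Matrix.det_fin_two, Matrix.mul_apply, Fin.sum_univ_two,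
      Matrix.adjugate_fin_two, Matrix.of_apply, Matrix.cons_val', Matrix.cons_val_zero,
      Matrix.cons_val_one, Matrix.cons_val_fin_one]
    have e00 := e 0 0
    have e01 := e 0 1
    have e10 := e 1 0
    have e11 := e 1 1
    rw [hs] at *
    linear_combination I 1 1 * e00 - I 0 1 * e10 - I 0 1 * e01 + I 0 0 * e11
  have d : A.det * I.det = c ^ 2 * h.det := by
    rw [← Matrix.det_transpose A, ← Matrix.det_mul, hA, Matrix.det_smul]
    simp
  rw [umbilicDiscriminant]
  linear_combination (A.trace * I.det + c * (I.adjugate * h).trace) * t - 4 * I.det * d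

variable {V : Type*} [AddCommGroup V] [Module ℝ V] {b : Module.Basis (Fin 2) ℝ V}
  {f : V →ₗ[ℝ] V} {A : Matrix (Fin 2) (Fin 2) ℝ}

theorem discriminant_eq_zero_of_smul (hA : ∀ i, f (b i) = ∑ k, A k i • b k) {c : ℝ}
    (hf : ∀ v, f v = c • v) : A.trace ^ 2 - 4 * A.det = 0 := by
  have e : ∀ i k, A k i = if i = k then c else 0 := by
    intro i k
    have h1 : b.repr (f (b i)) k = A k i := by
      rw [hA, map_sum]
      simp [Finsupp.single_apply, Fin.sum_univ_two]
      fin_cases k <;> simp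
    rw [← h1, hf, map_smul]
    simp [Finsupp.single_apply]
  simp [Matrix.trace_fin_two, Matrix.det_fin_two, e]
  ring

/-- A positive discriminant gives two distinct real eigenvalues, and their eigenvectors are a
basis. -/
theorem exists_eigenbasis_of_discriminant_pos (hA : ∀ i, f (b i) = ∑ k, A k i • b k)
    (hpos : 0 < A.trace ^ 2 - 4 * A.det) :
    ∃ (b' : Module.Basis (Fin 2) ℝ V) (k : Fin 2 → ℝ), ∀ i, f (b' i) = k i • b' i := by
  set s := √(A.trace ^ 2 - 4 * A.det) with hs
  have hs2 : s ^ 2 = A.trace ^ 2 - 4 * A.det := Real.sq_sqrt hpos.le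
  have hs0 : 0 < s := Real.sqrt_pos.2 hpos
  have hev : ∀ μ : ℝ, μ ^ 2 - A.trace * μ + A.det = 0 → ∃ v : V, v ≠ 0 ∧ f v = μ • v := by
    intro μ hμ
    have hdet : (A - Matrix.scalar (Fin 2) μ).det = 0 := by
      rw [← hμ]
      simp [Matrix.det_fin_two, Matrix.trace_fin_two]
      ring
    obtain ⟨u, hu, hu0⟩ := Matrix.exists_mulVec_eq_zero_iff.2 hdet
    refine ⟨b.equivFun.symm u, (LinearEquiv.map_ne_zero_iff _).2 hu, ?_⟩
    have h0 := congrFun hu0 0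
    have h1 := congrFun hu0 1
    simp [Matrix.mulVec, dotProduct, Fin.sum_univ_two] at h0 h1
    simp only [Module.Basis.equivFun_symm_apply, Fin.sum_univ_two, map_add, map_smul, hA]
    calc _ = (A 0 0 * u 0 + A 0 1 * u 1) • b 0 + (A 1 0 * u 0 + A 1 1 * u 1) • b 1 := by module
      _ = (μ * u 0) • b 0 + (μ * u 1) • b 1 := by
        congr 2
        · linear_combination h0
        · linear_combination h1
      _ = _ := by module
  obtain ⟨v, hv, hfv⟩ := hev ((A.trace + s) / 2) (by linear_combination (1 / 4) * hs2)
  obtain ⟨w, hw, hfw⟩ := hev ((A.trace - s) / 2) (by linear_combination (1 / 4) * hs2)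
  have hli : LinearIndependent ℝ ![v, w] := by
    refine Module.End.eigenvectors_linearIndependent' f
      ![(A.trace + s) / 2, (A.trace - s) / 2] ?_ _ fun i ↦ ?_
    · intro i j hij
      fin_cases i <;> fin_cases j <;> simp at hij ⊢ <;> linarith
    · fin_cases i
      · exact Module.End.hasEigenvector_iff.2 ⟨Module.End.mem_eigenspace_iff.2 hfv, hv⟩
      · exact Module.End.hasEigenvector_iff.2 ⟨Module.End.mem_eigenspace_iff.2 hfw, hw⟩
  have hcard : Fintype.card (Fin 2) = Module.finrank ℝ V :=
    (Module.finrank_eq_card_basis b).symm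
  refine ⟨basisOfLinearIndependentOfCardEqFinrank hli hcard,
    ![(A.trace + s) / 2, (A.trace - s) / 2], fun i ↦ ?_⟩
  rw [coe_basisOfLinearIndependentOfCardEqFinrank]
  fin_cases i
  · exact hfv
  · exact hfw

end Discriminant

section SurfaceInCoordinates

variable {G : EuclideanSpace ℝ (Fin 3) → Matrix (Fin 3) (Fin 3) ℝ}
  {F : EuclideanSpace ℝ (Fin 2) → EuclideanSpace ℝ (Fin 3)}
  {I : EuclideanSpace ℝ (Fin 2) → Matrix (Fin 2) (Fin 2) ℝ} {x : EuclideanSpace ℝ (Fin 2)}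

/-- The normal covector `n = ∂₁F × ∂₂F` of a surface `F` in coordinates. It annihilates the tangent
plane, and unlike the unit normal vector it extends over the lightlike points. -/
def normalCovector (F : EuclideanSpace ℝ (Fin 2) → EuclideanSpace ℝ (Fin 3))
    (x : EuclideanSpace ℝ (Fin 2)) : Fin 3 → ℝ :=
  cross (tangentCoord F 0 x) (tangentCoord F 1 x)

/-- The second fundamental form `n(∇ᵢ∂ⱼF)` with respect to the normal covector `n`. -/
def secondFormCoord (G : EuclideanSpace ℝ (Fin 3) → Matrix (Fin 3) (Fin 3) ℝ)
    (F : EuclideanSpace ℝ (Fin 2) → EuclideanSpace ℝ (Fin 3)) (x : EuclideanSpace ℝ (Fin 2)) :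
    Matrix (Fin 2) (Fin 2) ℝ :=
  Matrix.of fun i j ↦ ∑ k, normalCovector F x k * covDerivCoord G F (tangentCoord F j) i x k

theorem pairing_eq_sum {m : ℕ} (A : Matrix (Fin m) (Fin m) ℝ) (v w : Fin m → ℝ) :
    pairing A v w = ∑ l, (∑ k, A k l * v k) * w l := by
  rw [pairing, Finset.sum_comm]
  simp only [Finset.sum_mul]

theorem ContDiffAt.normalCovector (hF : ContDiffAt ℝ ∞ F x) (k : Fin 3) :
    ContDiffAt ℝ ∞ (fun y ↦ _root_.normalCovector F y k) x := by
  have h := hF.tangentCoord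
  fin_cases k
  · exact ((h 0 1).mul (h 1 2)).sub ((h 0 2).mul (h 1 1))
  · exact ((h 0 2).mul (h 1 0)).sub ((h 0 0).mul (h 1 2))
  · exact ((h 0 0).mul (h 1 1)).sub ((h 0 1).mul (h 1 0))

theorem ContDiffAt.secondFormCoord (hF : ContDiffAt ℝ ∞ F x)
    (hG : ∀ k l, ContDiffAt ℝ ∞ (fun z ↦ G z k l) (F x)) (hd : (G (F x)).det ≠ 0)
    (i j : Fin 2) : ContDiffAt ℝ ∞ (fun y ↦ _root_.secondFormCoord G F y i j) x := by
  simp only [_root_.secondFormCoord, Matrix.of_apply]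
  refine ContDiffAt.sum fun k _ ↦ (hF.normalCovector k).mul ?_
  refine (hF.tangentCoord j k).partialDeriv.add
    (ContDiffAt.sum fun a _ ↦ ContDiffAt.sum fun b _ ↦ ?_)
  exact (((ContDiffAt.christoffel hG hd k a b).comp x hF).mul (hF.tangentCoord i a)).mul
    (hF.tangentCoord j b)

theorem continuousAt_umbilicDiscriminant
    (hI : ∀ i j, ContDiffAt ℝ ∞ (fun y ↦ I y i j) x) (hF : ContDiffAt ℝ ∞ F x)
    (hG : ∀ k l, ContDiffAt ℝ ∞ (fun z ↦ G z k l) (F x)) (hd : (G (F x)).det ≠ 0) :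
    ContinuousAt (fun y ↦ umbilicDiscriminant (I y) (secondFormCoord G F y)) x := by
  have hh : ∀ i j, ContinuousAt (fun y ↦ secondFormCoord G F y i j) x := fun i j ↦
    (ContDiffAt.secondFormCoord hF hG hd i j).continuousAt
  have ha : ∀ i j, ContinuousAt (fun y ↦ (I y).adjugate i j) x := fun i j ↦
    (ContDiffAt.matrix_adjugate hI i j).continuousAt
  have hID := (ContDiffAt.matrix_det hI).continuousAt
  have hhD := (ContDiffAt.matrix_det (ContDiffAt.secondFormCoord hF hG hd)).continuousAt
  have ht : ContinuousAt (fun y ↦ ((I y).adjugate * secondFormCoord G F y).trace) x := by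
    simp only [Matrix.trace_fin_two, Matrix.mul_apply, Fin.sum_univ_two]
    exact (((ha 0 0).mul (hh 0 0)).add ((ha 0 1).mul (hh 1 0))).add
      (((ha 1 0).mul (hh 0 1)).add ((ha 1 1).mul (hh 1 1)))
  exact (ht.pow 2).sub ((continuousAt_const.mul hID).mul hhD)

/-- At a non-degenerate lightlike point near which the Gaussian curvature is bounded, the umbilic
discriminant is positive. There `adj I = m ξξᵀ` for a null vector `ξ`, so the discriminant is
`(m h(ξ, ξ))²`; and `h(ξ, ξ)` does not vanish because the covector `⟨dF(ξ), ·⟩` annihilates the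
tangent plane, whence it is a multiple of `n`, and `⟨dF(ξ), ∇_ξ dF(ξ)⟩ = [ξξ, ξ] ≠ 0`. -/
theorem umbilicDiscriminant_pos
    (hI : ∀ᶠ y in 𝓝 x, ∀ i j,
      I y i j = pairing (G (F y)) (tangentCoord F i y) (tangentCoord F j y))
    (hIsm : ∀ᶠ y in 𝓝 x, ∀ i j, ContDiffAt ℝ ∞ (fun y ↦ I y i j) y) (hIs : ∀ y, (I y).IsSymm)
    (hF : ContDiffAt ℝ ∞ F x) (hG : ∀ k l, ContDiffAt ℝ ∞ (fun z ↦ G z k l) (F x))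
    (hs : ∀ z, (G z).IsSymm) (hd : (G (F x)).det ≠ 0) (hn : normalCovector F x ≠ 0)
    (hx : (I x).det = 0) (hdx : fderiv ℝ (fun y ↦ (I y).det) x ≠ 0) {C : ℝ}
    (hK : ∀ᶠ y in 𝓝 x, (I y).det ≠ 0 → |gaussCurvatureOfCoeff I y| ≤ C) :
    0 < umbilicDiscriminant (I x) (secondFormCoord G F x) := by
  obtain ⟨ξ, hξ, hnull⟩ := Matrix.exists_mulVec_eq_zero_iff.2 hx
  have hne := christoffelFirst_null_ne_zero hIsm hIs hdx hξ hnull hK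
  obtain ⟨m, h00, h01, h10, h11⟩ := exists_coeff_of_null (hIs x) hξ hnull
  have hm : m ≠ 0 := fun hm ↦ hdx <| fderiv_eq_zero_of_partialDeriv fun a ↦ by
    rw [partialDeriv_det_of_coeff hIsm.self_of_nhds hIs h00 h01 h10 h11, hm]
    simp
  -- the covector `⟨dF(ξ), ·⟩`
  set α : Fin 3 → ℝ := fun l ↦ ∑ k, G (F x) k l * ∑ i, ξ i * tangentCoord F i x k with hα
  have hα' : ∀ w, ∑ i, ξ i * pairing (G (F x)) (tangentCoord F i x) w = ∑ l, α l * w l := by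
    intro w
    rw [← pairing_sum_smul_left, pairing_eq_sum]
  have hαt : ∀ j, ∑ l, α l * tangentCoord F j x l = 0 := by
    intro j
    rw [← hα']
    have := congrFun hnull j
    rw [Matrix.mulVec, dotProduct] at this
    rw [← Pi.zero_apply (M := fun _ ↦ ℝ) j, ← this]
    refine Finset.sum_congr rfl fun i _ ↦ ?_
    rw [← hI.self_of_nhds, (hIs x).apply, mul_comm]
  obtain ⟨c, hc⟩ := exists_eq_smul_cross hn (hαt 0) (hαt 1)
  have hch : ∀ i j, ∑ l, ξ l * christoffelFirst I i j l x = c * secondFormCoord G F x i j := by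
    intro i j
    have hGd : ∀ k l, DifferentiableAt ℝ (fun z ↦ G z k l) (F x) := fun k l ↦
      (hG k l).differentiableAt (by simp)
    simp only [christoffelFirst_induced hI hF hGd hs hd]
    simp only [pairing_comm (w := tangentCoord F _ x) (hs (F x))]
    rw [hα', secondFormCoord, Matrix.of_apply, Finset.mul_sum]
    refine Finset.sum_congr rfl fun k _ ↦ ?_
    rw [hc, normalCovector]
    ring
  have hsum : ∑ i, ∑ j, ∑ l, ξ i * ξ j * ξ l * christoffelFirst I i j l x
      = c * ∑ i, ∑ j, ξ i * ξ j * secondFormCoord G F x i j := by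
    simp only [Finset.mul_sum]
    refine Finset.sum_congr rfl fun i _ ↦ Finset.sum_congr rfl fun j _ ↦ ?_
    rw [show c * (ξ i * ξ j * secondFormCoord G F x i j)
      = ξ i * ξ j * (c * secondFormCoord G F x i j) by ring, ← hch, Finset.mul_sum]
    exact Finset.sum_congr rfl fun l _ ↦ by ring
  have hh : ∑ i, ∑ j, ξ i * ξ j * secondFormCoord G F x i j ≠ 0 := fun h ↦ hne (by
    rw [hsum, h, mul_zero])
  have ht : ((I x).adjugate * secondFormCoord G F x).trace
      = m * ∑ i, ∑ j, ξ i * ξ j * secondFormCoord G F x i j := by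
    simp only [Matrix.trace_fin_two, Matrix.mul_apply, Fin.sum_univ_two,
      Matrix.adjugate_fin_two, Matrix.of_apply, Matrix.cons_val', Matrix.cons_val_zero,
      Matrix.cons_val_one, Matrix.cons_val_fin_one, h00, h01, h10, h11]
    ring
  rw [umbilicDiscriminant, hx, ht]
  have := mul_ne_zero hm hh
  simp only [mul_zero, zero_mul, sub_zero]
  positivity

/-- The Weingarten equation: for a normal field `V` along the surface with `⟨V, ·⟩ = c n` at `x`,
`⟨-∇ᵢV, ∂ⱼF⟩ = c hᵢⱼ`. -/
theorem pairing_covDerivCoord_normal {V : EuclideanSpace ℝ (Fin 2) → Fin 3 → ℝ}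
    (hF : ContDiffAt ℝ ∞ F x) (hG : ∀ k l, ContDiffAt ℝ ∞ (fun z ↦ G z k l) (F x))
    (hs : ∀ z, (G z).IsSymm) (hd : (G (F x)).det ≠ 0)
    (hV : ∀ k, DifferentiableAt ℝ (fun y ↦ V y k) x)
    (hn : ∀ᶠ y in 𝓝 x, ∀ j, pairing (G (F y)) (V y) (tangentCoord F j y) = 0)
    {c : ℝ} (hc : ∀ l, ∑ k, G (F x) k l * V x k = c * normalCovector F x l) (i j : Fin 2) :
    pairing (G (F x)) (covDerivCoord G F V i x) (tangentCoord F j x)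
      = -(c * secondFormCoord G F x i j) := by
  have h := partialDeriv_pairing (hF.differentiableAt (by simp))
    (fun k l ↦ (hG k l).differentiableAt (by simp)) hs hd hV
    (fun k ↦ (hF.tangentCoord j k).differentiableAt (by simp)) i
  have h0 : partialDeriv i (fun y ↦ pairing (G (F y)) (V y) (tangentCoord F j y)) x = 0 := by
    rw [EventuallyEq.partialDeriv_eq (hn.mono fun y hy ↦ hy j)]
    simp [partialDeriv]
  have h1 : pairing (G (F x)) (V x) (covDerivCoord G F (tangentCoord F j) i x)
      = c * secondFormCoord G F x i j := by
    rw [pairing_eq_sum, secondFormCoord, Matrix.of_apply, Finset.mul_sum]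
    refine Finset.sum_congr rfl fun k _ ↦ ?_
    rw [hc]
    ring
  linarith

/-- The derivative of a unit field is orthogonal to the field. -/
theorem pairing_covDerivCoord_self {V : EuclideanSpace ℝ (Fin 2) → Fin 3 → ℝ}
    (hF : ContDiffAt ℝ ∞ F x) (hG : ∀ k l, ContDiffAt ℝ ∞ (fun z ↦ G z k l) (F x))
    (hs : ∀ z, (G z).IsSymm) (hd : (G (F x)).det ≠ 0)
    (hV : ∀ k, DifferentiableAt ℝ (fun y ↦ V y k) x) {ε : ℝ}
    (hn : ∀ᶠ y in 𝓝 x, pairing (G (F y)) (V y) (V y) = ε) (i : Fin 2) :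
    pairing (G (F x)) (covDerivCoord G F V i x) (V x) = 0 := by
  have h := partialDeriv_pairing (hF.differentiableAt (by simp))
    (fun k l ↦ (hG k l).differentiableAt (by simp)) hs hd hV hV i
  have h0 : partialDeriv i (fun y ↦ pairing (G (F y)) (V y) (V y)) x = 0 := by
    rw [EventuallyEq.partialDeriv_eq hn]
    simp [partialDeriv]
  rw [pairing_comm (v := V x) (hs _)] at h
  linarith

end SurfaceInCoordinates

/-! ### Components of tangent vectors in arbitrary smooth charts -/

section Charts

variable {n : ℕ} {N : Type*} [TopologicalSpace N] [ChartedSpace (EuclideanSpace ℝ (Fin n)) N]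
  {e : OpenPartialHomeomorph N (EuclideanSpace ℝ (Fin n))}

theorem mdifferentiable_of_mem_maximalAtlas (he : e ∈ IsManifold.maximalAtlas (𝓡 n) ∞ N) :
    e.MDifferentiable (𝓡 n) (𝓡 n) :=
  ⟨(contMDiffOn_of_mem_maximalAtlas he).mdifferentiableOn (by simp),
    (contMDiffOn_symm_of_mem_maximalAtlas he).mdifferentiableOn (by simp)⟩

theorem sum_smul_coordVec (y : EuclideanSpace ℝ (Fin n)) (v : EuclideanSpace ℝ (Fin n)) :
    ∑ i, v i • coordVec e i y = chartSymmDeriv e y v := by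
  conv_rhs => rw [← (EuclideanSpace.basisFun (Fin n) ℝ).sum_repr v]
  simp only [map_sum, map_smul, coordVec]
  simp

theorem chartDeriv_chartSymmDeriv (he : e ∈ IsManifold.maximalAtlas (𝓡 n) ∞ N)
    {y : EuclideanSpace ℝ (Fin n)} (hy : y ∈ e.target) (v : EuclideanSpace ℝ (Fin n)) :
    chartDeriv e (e.symm y) (chartSymmDeriv e y v) = v :=
  DFunLike.congr_fun ((mdifferentiable_of_mem_maximalAtlas he).comp_symm_deriv hy) v


theorem chartSymmDeriv_chartDeriv (he : e ∈ IsManifold.maximalAtlas (𝓡 n) ∞ N)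
    {y : EuclideanSpace ℝ (Fin n)} (hy : y ∈ e.target) (v : TangentSpace (𝓡 n) (e.symm y)) :
    chartSymmDeriv e y (chartDeriv e (e.symm y) v) = v := by
  have hinj := (mdifferentiable_of_mem_maximalAtlas he).mfderiv_injective (e.map_target hy)
  exact hinj (chartDeriv_chartSymmDeriv he hy _)

theorem eq_sum_smul_coordVec (he : e ∈ IsManifold.maximalAtlas (𝓡 n) ∞ N)
    {y : EuclideanSpace ℝ (Fin n)} (hy : y ∈ e.target) (v : TangentSpace (𝓡 n) (e.symm y)) :
    v = ∑ i, (chartDeriv e (e.symm y) v) i • coordVec e i y := by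
  rw [sum_smul_coordVec, chartSymmDeriv_chartDeriv he hy]

theorem chartDeriv_coordVec (he : e ∈ IsManifold.maximalAtlas (𝓡 n) ∞ N)
    {y : EuclideanSpace ℝ (Fin n)} (hy : y ∈ e.target) (i : Fin n) :
    chartDeriv e (e.symm y) (coordVec e i y) = EuclideanSpace.single i (1 : ℝ) :=
  chartDeriv_chartSymmDeriv he hy _

/-- The coordinate vectors of a chart, as a basis of the tangent space. -/
def coordBasis (he : e ∈ IsManifold.maximalAtlas (𝓡 n) ∞ N)
    {y : EuclideanSpace ℝ (Fin n)} (hy : y ∈ e.target) :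
    Module.Basis (Fin n) ℝ (TangentSpace (𝓡 n) (e.symm y)) :=
  (EuclideanSpace.basisFun (Fin n) ℝ).toBasis.map
    (LinearEquiv.ofBijective (chartSymmDeriv e y : _ →ₗ[ℝ] _)
      ⟨fun v w h ↦ by
        rw [← chartDeriv_chartSymmDeriv he hy v, ← chartDeriv_chartSymmDeriv he hy w]
        exact congrArg _ h,
      fun v ↦ ⟨_, chartSymmDeriv_chartDeriv he hy v⟩⟩)

theorem coordBasis_apply (he : e ∈ IsManifold.maximalAtlas (𝓡 n) ∞ N)
    {y : EuclideanSpace ℝ (Fin n)} (hy : y ∈ e.target) (i : Fin n) :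
    coordBasis he hy i = coordVec e i y := by
  simp [coordBasis, coordVec]
  rfl

end Charts

/-! ### The ambient metric in a chart -/

section Ambient

variable {M : Type*} [TopologicalSpace M] [ChartedSpace (EuclideanSpace ℝ (Fin 3)) M]
  [IsManifold (𝓡 3) ∞ M] {g : LorentzianMetric M}
  {φ : OpenPartialHomeomorph M (EuclideanSpace ℝ (Fin 3))}

theorem metricCoeff_isSymm (y : EuclideanSpace ℝ (Fin 3)) : (metricCoeff g φ y).IsSymm :=
  Matrix.IsSymm.ext fun _ _ ↦ g.symm _ _ _

theorem inner_eq_pairing (hφ : φ ∈ IsManifold.maximalAtlas (𝓡 3) ∞ M) {m : M}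
    (hm : m ∈ φ.source) (v w : TangentSpace (𝓡 3) m) :
    g.inner m v w = pairing (metricCoeff g φ (φ m)) (components φ m v) (components φ m w) := by
  obtain ⟨y, hy, rfl⟩ : ∃ y ∈ φ.target, φ.symm y = m := ⟨φ m, φ.map_source hm, φ.left_inv hm⟩
  rw [φ.right_inv hy]
  conv_lhs => rw [eq_sum_smul_coordVec hφ hy v, eq_sum_smul_coordVec hφ hy w]
  simp only [map_sum, map_smul, sum_apply, smul_apply,
    smul_eq_mul, pairing, metricCoeff, Matrix.of_apply, components]
  simp only [Finset.mul_sum]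
  rw [Finset.sum_comm]
  exact Finset.sum_congr rfl fun k _ ↦ Finset.sum_congr rfl fun l _ ↦ by ring

theorem inner_nondegenerate {m : M} {v : TangentSpace (𝓡 3) m} (h : ∀ w, g.inner m v w = 0) :
    v = 0 := by
  obtain ⟨b, hb⟩ := g.exists_orthonormal m
  apply b.repr.injective
  ext i
  have h1 := h (b i)
  rw [← b.sum_repr v] at h1
  simp only [map_sum, map_smul, sum_apply, smul_apply,
    smul_eq_mul, hb] at h1
  simp at h1
  split_ifs at h1 <;> simpa using h1

theorem metricCoeff_det_ne_zero (hφ : φ ∈ IsManifold.maximalAtlas (𝓡 3) ∞ M)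
    {y : EuclideanSpace ℝ (Fin 3)} (hy : y ∈ φ.target) : (metricCoeff g φ y).det ≠ 0 := by
  intro h
  obtain ⟨v, hv, hv0⟩ := Matrix.exists_vecMul_eq_zero_iff.2 h
  apply hv
  have h1 : chartSymmDeriv φ y (WithLp.toLp 2 v) = 0 := by
    apply inner_nondegenerate (g := g)
    intro w
    rw [inner_eq_pairing hφ (φ.map_target hy), φ.right_inv hy, pairing_eq_sum]
    refine Finset.sum_eq_zero fun l _ ↦ ?_
    have := congrFun hv0 l
    rw [components, chartDeriv_chartSymmDeriv hφ hy]
    rw [Matrix.vecMul, dotProduct, Pi.zero_apply] at this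
    simp only [mul_comm (metricCoeff g φ y _ _), this, zero_mul]
  have h2 := chartDeriv_chartSymmDeriv hφ hy (WithLp.toLp 2 v)
  rw [h1, map_zero] at h2
  exact funext fun i ↦ congrArg (fun u : EuclideanSpace ℝ (Fin 3) ↦ u i) h2.symm

/-- A vector field along a map into the domain of a chart `e` is smooth if the map `c` and the
field `u` are smooth in the coordinates `e`. -/
theorem contMDiffAt_coordVec {n : ℕ} {N : Type*} [TopologicalSpace N]
    [ChartedSpace (EuclideanSpace ℝ (Fin n)) N] [IsManifold (𝓡 n) ∞ N]
    {e : OpenPartialHomeomorph N (EuclideanSpace ℝ (Fin n))}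
    (he : e ∈ IsManifold.maximalAtlas (𝓡 n) ∞ N)
    {X : Type*} [TopologicalSpace X] {E : Type*} [NormedAddCommGroup E] [NormedSpace ℝ E]
    [ChartedSpace E X] {c : X → EuclideanSpace ℝ (Fin n)} {u : X → EuclideanSpace ℝ (Fin n)}
    {x : X} (hc : ContMDiffAt 𝓘(ℝ, E) (𝓡 n) ∞ c x) (hu : ContMDiffAt 𝓘(ℝ, E) (𝓡 n) ∞ u x)
    (hx : c x ∈ e.target) :
    ContMDiffAt 𝓘(ℝ, E) (𝓡 n).tangent ∞ (fun y ↦ (⟨e.symm (c y), chartSymmDeriv e (c y) (u y)⟩ :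
      TangentBundle (𝓡 n) N)) x := by
  have h1 : ContMDiffOn (𝓡 n).tangent (𝓡 n).tangent ∞
      (tangentMapWithin (𝓡 n) (𝓡 n) e.symm e.target) (Bundle.TotalSpace.proj ⁻¹' e.target) :=
    (contMDiffOn_symm_of_mem_maximalAtlas he).contMDiffOn_tangentMapWithin (by simp)
      e.open_target.uniqueMDiffOn
  have h2 : ContMDiffAt 𝓘(ℝ, E) (𝓡 n).tangent ∞ (fun y ↦ (⟨c y, u y⟩ :
      TangentBundle (𝓡 n) (EuclideanSpace ℝ (Fin n)))) x :=
    Bundle.contMDiffAt_totalSpace.2 ⟨hc, by simpa using hu⟩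
  have h3 := (h1 _ hx).contMDiffAt (x := (⟨c x, u x⟩ : TangentBundle (𝓡 n) _))
    ((FiberBundle.continuous_proj _ _).continuousAt.preimage_mem_nhds
      (e.open_target.mem_nhds hx))
  refine (h3.comp x h2).congr_of_eventuallyEq ?_
  filter_upwards [hc.continuousAt.preimage_mem_nhds (e.open_target.mem_nhds hx)] with y hy
  simp only [Function.comp_apply, tangentMapWithin]
  rw [mfderivWithin_of_isOpen e.open_target hy]
  rfl

theorem ContDiffAt.metricCoeff (hφ : φ ∈ IsManifold.maximalAtlas (𝓡 3) ∞ M)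
    {y : EuclideanSpace ℝ (Fin 3)} (hy : y ∈ φ.target) (k l : Fin 3) :
    ContDiffAt ℝ ∞ (fun z ↦ _root_.metricCoeff g φ z k l) y := by
  have hsymm : ContMDiffAt (𝓡 3) (𝓡 3) ∞ φ.symm y := contMDiffAt_symm_of_mem_maximalAtlas hφ hy
  have h1 := g.contMDiff.contMDiffAt.comp y hsymm
  have h2 : ∀ i, _ := fun i ↦ contMDiffAt_coordVec hφ (c := id) (x := y)
    (u := fun _ ↦ EuclideanSpace.single i (1 : ℝ)) contMDiffAt_id contMDiffAt_const hy
  have h3 := ContMDiffAt.clm_bundle_apply₂ (E₁ := fun x : M ↦ TangentSpace (𝓡 3) x)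
    (E₂ := fun x : M ↦ TangentSpace (𝓡 3) x) (E₃ := fun _ : M ↦ ℝ) (F₁ := EuclideanSpace ℝ (Fin 3))
    (F₂ := EuclideanSpace ℝ (Fin 3)) (F₃ := ℝ) h1 (h2 k) (h2 l)
  exact ((Bundle.contMDiffAt_totalSpace).1 h3).2.contDiffAt

end Ambient

/-! ### A surface in charts -/

section SurfaceInCharts

variable {S : Type*} [TopologicalSpace S] {M : Type*} [TopologicalSpace M] {f : S → M}
  {e : OpenPartialHomeomorph S (EuclideanSpace ℝ (Fin 2))}
  {φ : OpenPartialHomeomorph M (EuclideanSpace ℝ (Fin 3))}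
  {x : EuclideanSpace ℝ (Fin 2)}

/-- The map `f` in the coordinates `e` and `φ`. -/
def localRep (φ : OpenPartialHomeomorph M (EuclideanSpace ℝ (Fin 3))) (f : S → M)
    (e : OpenPartialHomeomorph S (EuclideanSpace ℝ (Fin 2))) (y : EuclideanSpace ℝ (Fin 2)) :
    EuclideanSpace ℝ (Fin 3) :=
  φ (f (e.symm y))

/-- The set of coordinates `y ∈ e.target` of the points that `f` maps to the domain of `φ`. -/
def localRepDomain (φ : OpenPartialHomeomorph M (EuclideanSpace ℝ (Fin 3))) (f : S → M)
    (e : OpenPartialHomeomorph S (EuclideanSpace ℝ (Fin 2))) : Set (EuclideanSpace ℝ (Fin 2)) :=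
  e.target ∩ e.symm ⁻¹' (f ⁻¹' φ.source)

theorem isOpen_localRepDomain (hf : Continuous f) : IsOpen (localRepDomain φ f e) :=
  e.isOpen_inter_preimage_symm (φ.open_source.preimage hf)

theorem contDiffAt_metricCoeff_localRep [ChartedSpace (EuclideanSpace ℝ (Fin 3)) M]
    [IsManifold (𝓡 3) ∞ M] {g : LorentzianMetric M} (hφ : φ ∈ IsManifold.maximalAtlas (𝓡 3) ∞ M)
    (hx : x ∈ localRepDomain φ f e) (k l : Fin 3) :
    ContDiffAt ℝ ∞ (fun z ↦ metricCoeff g φ z k l) (localRep φ f e x) :=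
  ContDiffAt.metricCoeff hφ (φ.map_source hx.2) k l

variable [ChartedSpace (EuclideanSpace ℝ (Fin 2)) S] [ChartedSpace (EuclideanSpace ℝ (Fin 3)) M]

theorem contDiffAt_localRep (he : e ∈ IsManifold.maximalAtlas (𝓡 2) ∞ S)
    (hφ : φ ∈ IsManifold.maximalAtlas (𝓡 3) ∞ M) (hf : ContMDiff (𝓡 2) (𝓡 3) ∞ f)
    (hx : x ∈ localRepDomain φ f e) : ContDiffAt ℝ ∞ (localRep φ f e) x := by
  have h1 := contMDiffAt_symm_of_mem_maximalAtlas he hx.1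
  have h2 := contMDiffAt_of_mem_maximalAtlas hφ hx.2
  exact (h2.comp x (hf.contMDiffAt.comp x h1)).contDiffAt

theorem mfderiv_comp_symm_coordVec {E : Type*} [NormedAddCommGroup E] [NormedSpace ℝ E]
    (he : e ∈ IsManifold.maximalAtlas (𝓡 2) ∞ S) (hx : x ∈ e.target) {h : S → E}
    (hh : MDifferentiableAt (𝓡 2) 𝓘(ℝ, E) h (e.symm x)) (i : Fin 2) :
    (mfderiv (𝓡 2) 𝓘(ℝ, E) h (e.symm x) (coordVec e i x) : E)
      = fderiv ℝ (fun y ↦ h (e.symm y)) x (EuclideanSpace.single i 1) := by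
  have h1 : MDifferentiableAt (𝓡 2) (𝓡 2) e.symm x :=
    (contMDiffAt_symm_of_mem_maximalAtlas he hx).mdifferentiableAt (by simp)
  have h2 := mfderiv_comp x hh h1
  rw [mfderiv_eq_fderiv] at h2
  exact (DFunLike.congr_fun h2 (EuclideanSpace.single i (1 : ℝ))).symm

theorem dirDeriv_coordVec (he : e ∈ IsManifold.maximalAtlas (𝓡 2) ∞ S) (hx : x ∈ e.target)
    {h : S → ℝ} (hh : MDifferentiableAt (𝓡 2) 𝓘(ℝ, ℝ) h (e.symm x)) (i : Fin 2) :
    dirDeriv h (e.symm x) (coordVec e i x) = partialDeriv i (fun y ↦ h (e.symm y)) x :=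
  mfderiv_comp_symm_coordVec he hx hh i

theorem components_mfderiv_coordVec (he : e ∈ IsManifold.maximalAtlas (𝓡 2) ∞ S)
    (hφ : φ ∈ IsManifold.maximalAtlas (𝓡 3) ∞ M) (hf : ContMDiff (𝓡 2) (𝓡 3) ∞ f)
    (hx : x ∈ localRepDomain φ f e) (i : Fin 2) :
    (components φ (f (e.symm x)) (mfderiv (𝓡 2) (𝓡 3) f (e.symm x) (coordVec e i x)) :
      Fin 3 → ℝ) = tangentCoord (localRep φ f e) i x := by
  have h1 : MDifferentiableAt (𝓡 3) (𝓡 3) φ (f (e.symm x)) :=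
    (contMDiffAt_of_mem_maximalAtlas hφ hx.2).mdifferentiableAt (by simp)
  have h2 : MDifferentiableAt (𝓡 2) (𝓡 3) f (e.symm x) := hf.mdifferentiableAt (by simp)
  have h3 := mfderiv_comp_symm_coordVec he hx.1 (h1.comp _ h2) i
  rw [mfderiv_comp _ h1 h2] at h3
  have h4 : components φ (f (e.symm x)) (mfderiv (𝓡 2) (𝓡 3) f (e.symm x) (coordVec e i x))
      = fderiv ℝ (localRep φ f e) x (EuclideanSpace.single i 1) := h3
  rw [h4]
  funext k
  have h5 : HasFDerivAt (fun y ↦ localRep φ f e y k)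
      ((EuclideanSpace.proj k : _ →L[ℝ] ℝ).comp (fderiv ℝ (localRep φ f e) x)) x :=
    (EuclideanSpace.proj k : EuclideanSpace ℝ (Fin 3) →L[ℝ] ℝ).hasFDerivAt.comp x
      ((contDiffAt_localRep he hφ hf hx).differentiableAt (by simp)).hasFDerivAt
  simp [tangentCoord, partialDeriv, h5.fderiv]

theorem normalCovector_localRep_ne_zero (he : e ∈ IsManifold.maximalAtlas (𝓡 2) ∞ S)
    (hφ : φ ∈ IsManifold.maximalAtlas (𝓡 3) ∞ M) (hf : ContMDiff (𝓡 2) (𝓡 3) ∞ f)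
    (hinj : ∀ q, Function.Injective (mfderiv (𝓡 2) (𝓡 3) f q))
    (hx : x ∈ localRepDomain φ f e) : normalCovector (localRep φ f e) x ≠ 0 := by
  refine cross_ne_zero (LinearIndependent.pair_iff.2 fun s t hst ↦ ?_)
  set v := s • coordVec e 0 x + t • coordVec e 1 x with hv
  have h1 : components φ (f (e.symm x)) (mfderiv (𝓡 2) (𝓡 3) f (e.symm x) v)
      = (0 : EuclideanSpace ℝ (Fin 3)) := by
    ext k
    rw [← components_mfderiv_coordVec he hφ hf hx, ← components_mfderiv_coordVec he hφ hf hx]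
      at hst
    have := congrFun hst k
    rw [hv, map_add, map_smul, map_smul, components, map_add, map_smul, map_smul]
    exact this
  have h2 : mfderiv (𝓡 2) (𝓡 3) f (e.symm x) v = 0 :=
    (mdifferentiable_of_mem_maximalAtlas hφ).mfderiv_injective hx.2 (by
      rw [map_zero]
      exact h1)
  have h3 : v = 0 := hinj _ (by rw [h2, map_zero])
  have h4 := congrArg (chartDeriv e (e.symm x)) h3
  rw [hv, map_add, map_smul, map_smul, chartDeriv_coordVec he hx.1, chartDeriv_coordVec he hx.1,
    map_zero] at h4
  exact ⟨by simpa using congrArg (fun u : EuclideanSpace ℝ (Fin 2) ↦ u 0) h4,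
    by simpa using congrArg (fun u : EuclideanSpace ℝ (Fin 2) ↦ u 1) h4⟩

variable [IsManifold (𝓡 3) ∞ M] {g : LorentzianMetric M}

theorem firstFFCoeff_isSymm (y : EuclideanSpace ℝ (Fin 2)) : (firstFFCoeff g f e y).IsSymm :=
  Matrix.IsSymm.ext fun _ _ ↦ g.symm _ _ _

theorem firstFFCoeff_eq_pairing (he : e ∈ IsManifold.maximalAtlas (𝓡 2) ∞ S)
    (hφ : φ ∈ IsManifold.maximalAtlas (𝓡 3) ∞ M) (hf : ContMDiff (𝓡 2) (𝓡 3) ∞ f)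
    (hx : x ∈ localRepDomain φ f e) (i j : Fin 2) :
    firstFFCoeff g f e x i j = pairing (metricCoeff g φ (localRep φ f e x))
      (tangentCoord (localRep φ f e) i x) (tangentCoord (localRep φ f e) j x) := by
  rw [firstFFCoeff, Matrix.of_apply, firstFF, inner_eq_pairing hφ hx.2,
    components_mfderiv_coordVec he hφ hf hx, components_mfderiv_coordVec he hφ hf hx]
  rfl

theorem contDiffAt_pairing {E : Type*} [NormedAddCommGroup E] [NormedSpace ℝ E] {m : ℕ} {y : E}
    {A : E → Matrix (Fin m) (Fin m) ℝ} {v w : E → Fin m → ℝ}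
    (hA : ∀ k l, ContDiffAt ℝ ∞ (fun z ↦ A z k l) y)
    (hv : ∀ k, ContDiffAt ℝ ∞ (fun z ↦ v z k) y) (hw : ∀ k, ContDiffAt ℝ ∞ (fun z ↦ w z k) y) :
    ContDiffAt ℝ ∞ (fun z ↦ pairing (A z) (v z) (w z)) y :=
  ContDiffAt.sum fun k _ ↦ ContDiffAt.sum fun l _ ↦ ((hA k l).mul (hv k)).mul (hw l)

theorem contDiffAt_firstFFCoeff (he : e ∈ IsManifold.maximalAtlas (𝓡 2) ∞ S)
    (hφ : φ ∈ IsManifold.maximalAtlas (𝓡 3) ∞ M) (hf : ContMDiff (𝓡 2) (𝓡 3) ∞ f)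
    (hx : x ∈ localRepDomain φ f e) (i j : Fin 2) :
    ContDiffAt ℝ ∞ (fun y ↦ firstFFCoeff g f e y i j) x := by
  have hF := contDiffAt_localRep he hφ hf hx
  refine (contDiffAt_pairing (fun k l ↦
    (contDiffAt_metricCoeff_localRep (g := g) hφ hx k l).comp x hF)
    (hF.tangentCoord i) (hF.tangentCoord j)).congr_of_eventuallyEq ?_
  filter_upwards [(isOpen_localRepDomain hf.continuous).mem_nhds hx] with y hy
  exact firstFFCoeff_eq_pairing he hφ hf hy i j

theorem firstFF_eq_sum (he : e ∈ IsManifold.maximalAtlas (𝓡 2) ∞ S) (hx : x ∈ e.target)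
    (v w : TangentSpace (𝓡 2) (e.symm x)) :
    firstFF g f (e.symm x) v w = pairing (firstFFCoeff g f e x)
      (chartDeriv e (e.symm x) v) (chartDeriv e (e.symm x) w) := by
  conv_lhs => rw [eq_sum_smul_coordVec he hx v, eq_sum_smul_coordVec he hx w]
  simp only [firstFF, map_sum, map_smul, sum_apply, smul_apply, smul_eq_mul, pairing,
    firstFFCoeff, Matrix.of_apply, Finset.mul_sum]
  rw [Finset.sum_comm]
  exact Finset.sum_congr rfl fun k _ ↦ Finset.sum_congr rfl fun l _ ↦ by ring

theorem isLightlikePt_iff (he : e ∈ IsManifold.maximalAtlas (𝓡 2) ∞ S) (hx : x ∈ e.target) :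
    IsLightlikePt g f (e.symm x) ↔ (firstFFCoeff g f e x).det = 0 := by
  rw [← Matrix.exists_vecMul_eq_zero_iff]
  constructor
  · rintro ⟨v, hv, hvw⟩
    refine ⟨chartDeriv e (e.symm x) v, fun h ↦ hv ?_, funext fun j ↦ ?_⟩
    · have h' : chartDeriv e (e.symm x) v = (0 : EuclideanSpace ℝ (Fin 2)) := by
        ext i
        exact congrFun h i
      rw [← chartSymmDeriv_chartDeriv he hx v, h', map_zero]
    · have := hvw (coordVec e j x)
      rw [firstFF_eq_sum he hx, chartDeriv_coordVec he hx, pairing_eq_sum] at this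
      rw [Matrix.vecMul, dotProduct, Pi.zero_apply, ← this]
      simp [PiLp.single_apply, mul_comm]
  · rintro ⟨u, hu, hu0⟩
    have h1 := chartDeriv_chartSymmDeriv he hx (WithLp.toLp 2 u)
    refine ⟨chartSymmDeriv e x (WithLp.toLp 2 u), fun h ↦ hu ?_, fun w ↦ ?_⟩
    · rw [h, map_zero] at h1
      exact funext fun i ↦ congrArg (fun u : EuclideanSpace ℝ (Fin 2) ↦ u i) h1.symm
    · rw [firstFF_eq_sum he hx, h1, pairing_eq_sum]
      refine Finset.sum_eq_zero fun l _ ↦ ?_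
      have := congrFun hu0 l
      rw [Matrix.vecMul, dotProduct, Pi.zero_apply] at this
      simp only [mul_comm (firstFFCoeff g f e x _ _), this, zero_mul]

theorem IsTimelikePt.det_neg (he : e ∈ IsManifold.maximalAtlas (𝓡 2) ∞ S) (hx : x ∈ e.target)
    (h : IsTimelikePt g f (e.symm x)) : (firstFFCoeff g f e x).det < 0 := by
  obtain ⟨⟨v, hv⟩, w, hw⟩ := h
  rw [firstFF_eq_sum he hx] at hv hw
  have hs := (firstFFCoeff_isSymm (g := g) (f := f) (e := e) x).apply 0 1
  set a := chartDeriv e (e.symm x) v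
  set b := chartDeriv e (e.symm x) w
  set I := firstFFCoeff g f e x
  -- the Gram determinant of `v` and `w`
  have h1 : pairing I a a * pairing I b b - pairing I a b ^ 2
      = I.det * (a 0 * b 1 - a 1 * b 0) ^ 2 := by
    simp only [pairing, Fin.sum_univ_two, Matrix.det_fin_two, hs]
    ring
  by_contra hneg
  have h2 := mul_neg_of_pos_of_neg hv hw
  have h3 := mul_nonneg (not_lt.1 hneg) (sq_nonneg (a 0 * b 1 - a 1 * b 0))
  linarith [sq_nonneg (pairing I a b)]

end SurfaceInCharts

/-! ### Unit normal fields and shape operators in charts -/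

section NormalFields

variable {S : Type*} [TopologicalSpace S] [ChartedSpace (EuclideanSpace ℝ (Fin 2)) S]
  {M : Type*} [TopologicalSpace M] [ChartedSpace (EuclideanSpace ℝ (Fin 3)) M]
  {f : S → M} {e : OpenPartialHomeomorph S (EuclideanSpace ℝ (Fin 2))}
  {φ : OpenPartialHomeomorph M (EuclideanSpace ℝ (Fin 3))}
  {x : EuclideanSpace ℝ (Fin 2)}
  {ν : ∀ q : S, TangentSpace (𝓡 3) (f q)} {W : Set S}

theorem components_chartSymmDeriv (hφ : φ ∈ IsManifold.maximalAtlas (𝓡 3) ∞ M) {m : M}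
    (hm : m ∈ φ.source) (v : EuclideanSpace ℝ (Fin 3)) :
    components φ m (chartSymmDeriv φ (φ m) v : EuclideanSpace ℝ (Fin 3)) = v := by
  obtain ⟨y, hy, rfl⟩ : ∃ y ∈ φ.target, φ.symm y = m := ⟨φ m, φ.map_source hm, φ.left_inv hm⟩
  have : ∀ z, z = y →
      components φ (φ.symm y) (chartSymmDeriv φ z v : EuclideanSpace ℝ (Fin 3)) = v := by
    rintro z rfl
    exact chartDeriv_chartSymmDeriv hφ hy v
  exact this _ (φ.right_inv hy)

theorem components_injective (hφ : φ ∈ IsManifold.maximalAtlas (𝓡 3) ∞ M) {m : M}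
    (hm : m ∈ φ.source) : Function.Injective (components φ m) :=
  (mdifferentiable_of_mem_maximalAtlas hφ).mfderiv_injective hm

variable [IsManifold (𝓡 3) ∞ M] {g : LorentzianMetric M}

/-- The components of a vector field along `f`, as functions of the coordinates of the surface. -/
def fieldRep (φ : OpenPartialHomeomorph M (EuclideanSpace ℝ (Fin 3)))
    (e : OpenPartialHomeomorph S (EuclideanSpace ℝ (Fin 2)))
    (ν : ∀ q : S, TangentSpace (𝓡 3) (f q)) (y : EuclideanSpace ℝ (Fin 2)) (k : Fin 3) : ℝ :=
  components φ (f (e.symm y)) (ν (e.symm y)) k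

theorem IsUnitNormalOn.contMDiffAt_components (hν : IsUnitNormalOn g f ν W) (hW : IsOpen W)
    (hφ : φ ∈ IsManifold.maximalAtlas (𝓡 3) ∞ M) {q : S} (hq : q ∈ W) (hqφ : f q ∈ φ.source) :
    ContMDiffAt (𝓡 2) (𝓡 3) ∞ (fun q' ↦ components φ (f q') (ν q')) q := by
  have h1 : ContMDiffOn (𝓡 3).tangent (𝓡 3).tangent ∞
      (tangentMapWithin (𝓡 3) (𝓡 3) φ φ.source) (Bundle.TotalSpace.proj ⁻¹' φ.source) :=
    (contMDiffOn_of_mem_maximalAtlas hφ).contMDiffOn_tangentMapWithin (by simp)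
      φ.open_source.uniqueMDiffOn
  have h2 := hν.contMDiffOn.contMDiffAt (hW.mem_nhds hq)
  have h3 := (h1 (⟨f q, ν q⟩ : TangentBundle (𝓡 3) M) hqφ).contMDiffAt
    ((FiberBundle.continuous_proj _ _).continuousAt.preimage_mem_nhds
      (φ.open_source.mem_nhds hqφ))
  have hfc : ContinuousAt f q := (Bundle.contMDiffAt_totalSpace.1 h2).1.continuousAt
  have hsnd := contMDiff_snd_tangentBundle_modelSpace (n := ∞) (EuclideanSpace ℝ (Fin 3)) (𝓡 3)
  refine (hsnd.contMDiffAt.comp q (h3.comp q h2)).congr_of_eventuallyEq ?_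
  filter_upwards [hfc.preimage_mem_nhds (φ.open_source.mem_nhds hqφ)] with q' hq'
  have h4 : mfderivWithin (𝓡 3) (𝓡 3) φ φ.source (f q') = mfderiv (𝓡 3) (𝓡 3) φ (f q') :=
    mfderivWithin_of_isOpen φ.open_source hq'
  exact (DFunLike.congr_fun h4 (ν q')).symm

theorem IsUnitNormalOn.contMDiffAt_component (hν : IsUnitNormalOn g f ν W) (hW : IsOpen W)
    (hφ : φ ∈ IsManifold.maximalAtlas (𝓡 3) ∞ M) {q : S} (hq : q ∈ W) (hqφ : f q ∈ φ.source)
    (k : Fin 3) : ContMDiffAt (𝓡 2) 𝓘(ℝ, ℝ) ∞ (fun q' ↦ components φ (f q') (ν q') k) q :=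
  (EuclideanSpace.proj k : EuclideanSpace ℝ (Fin 3) →L[ℝ] ℝ).contMDiff.contMDiffAt.comp q
    (hν.contMDiffAt_components hW hφ hq hqφ)

theorem IsUnitNormalOn.contDiffAt_fieldRep (hν : IsUnitNormalOn g f ν W) (hW : IsOpen W)
    (he : e ∈ IsManifold.maximalAtlas (𝓡 2) ∞ S) (hφ : φ ∈ IsManifold.maximalAtlas (𝓡 3) ∞ M)
    (hx : x ∈ localRepDomain φ f e) (hxW : e.symm x ∈ W) (k : Fin 3) :
    ContDiffAt ℝ ∞ (fun y ↦ fieldRep φ e ν y k) x :=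
  ((hν.contMDiffAt_component hW hφ hxW hx.2 k).comp x
    (contMDiffAt_symm_of_mem_maximalAtlas he hx.1)).contDiffAt

theorem pairing_fieldRep_tangentCoord (he : e ∈ IsManifold.maximalAtlas (𝓡 2) ∞ S)
    (hφ : φ ∈ IsManifold.maximalAtlas (𝓡 3) ∞ M) (hf : ContMDiff (𝓡 2) (𝓡 3) ∞ f)
    (hx : x ∈ localRepDomain φ f e) (ν : ∀ q : S, TangentSpace (𝓡 3) (f q)) (j : Fin 2) :
    pairing (metricCoeff g φ (localRep φ f e x)) (fieldRep φ e ν x)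
        (tangentCoord (localRep φ f e) j x)
      = g.inner (f (e.symm x)) (ν (e.symm x))
          (mfderiv (𝓡 2) (𝓡 3) f (e.symm x) (coordVec e j x)) := by
  rw [inner_eq_pairing hφ hx.2, components_mfderiv_coordVec he hφ hf hx]
  rfl

/-- By continuity the sign of `⟨ν, ν⟩ = ±1` is locally constant. -/
theorem IsUnitNormalOn.exists_sign (hν : IsUnitNormalOn g f ν W) (hW : IsOpen W)
    (he : e ∈ IsManifold.maximalAtlas (𝓡 2) ∞ S) (hφ : φ ∈ IsManifold.maximalAtlas (𝓡 3) ∞ M)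
    (hf : ContMDiff (𝓡 2) (𝓡 3) ∞ f) (hx : x ∈ localRepDomain φ f e) (hxW : e.symm x ∈ W) :
    ∃ ε : ℝ, ε ≠ 0 ∧ ∀ᶠ y in 𝓝 x, pairing (metricCoeff g φ (localRep φ f e y))
      (fieldRep φ e ν y) (fieldRep φ e ν y) = ε := by
  set P := fun y ↦ pairing (metricCoeff g φ (localRep φ f e y))
    (fieldRep φ e ν y) (fieldRep φ e ν y) with hP
  have hv := hν.contDiffAt_fieldRep hW he hφ hx hxW
  have hcont : ContinuousAt P x := (contDiffAt_pairing (fun k l ↦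
    (contDiffAt_metricCoeff_localRep (g := g) hφ hx k l).comp x
      (contDiffAt_localRep he hφ hf hx)) hv hv).continuousAt
  have hunit : ∀ y ∈ localRepDomain φ f e, e.symm y ∈ W → |P y| = 1 := by
    intro y hy hyW
    rw [← hν.unit _ hyW, inner_eq_pairing hφ hy.2]
    rfl
  have h0 : P x ≠ 0 := fun h ↦ by
    have := hunit x hx hxW
    rw [h] at this
    simp at this
  have hWx : ∀ᶠ y in 𝓝 x, e.symm y ∈ W :=
    (e.continuousAt_symm hx.1).preimage_mem_nhds (hW.mem_nhds hxW)
  have hnear : ∀ᶠ y in 𝓝 x, |P y - P x| < 1 := by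
    have := Metric.continuousAt_iff'.1 hcont 1 one_pos
    simpa [Real.dist_eq] using this
  refine ⟨P x, h0, ?_⟩
  filter_upwards [hWx, hnear, (isOpen_localRepDomain hf.continuous).mem_nhds hx] with y h1 h2 h3
  have h4 := hunit y h3 h1
  have h5 := hunit x hx hxW
  change P y = P x
  rcases eq_or_eq_neg_of_abs_eq h4 with h | h <;> rcases eq_or_eq_neg_of_abs_eq h5 with h' | h' <;>
    rw [h, h'] at h2 ⊢ <;> norm_num at h2

theorem IsUnitNormalOn.eventually_normal (hν : IsUnitNormalOn g f ν W) (hW : IsOpen W)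
    (he : e ∈ IsManifold.maximalAtlas (𝓡 2) ∞ S) (hφ : φ ∈ IsManifold.maximalAtlas (𝓡 3) ∞ M)
    (hf : ContMDiff (𝓡 2) (𝓡 3) ∞ f) (hx : x ∈ localRepDomain φ f e) (hxW : e.symm x ∈ W) :
    ∀ᶠ y in 𝓝 x, ∀ j, pairing (metricCoeff g φ (localRep φ f e y)) (fieldRep φ e ν y)
      (tangentCoord (localRep φ f e) j y) = 0 := by
  have hWx : ∀ᶠ y in 𝓝 x, e.symm y ∈ W :=
    (e.continuousAt_symm hx.1).preimage_mem_nhds (hW.mem_nhds hxW)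
  filter_upwards [hWx, (isOpen_localRepDomain hf.continuous).mem_nhds hx] with y h1 h2 j
  rw [pairing_fieldRep_tangentCoord he hφ hf h2, hν.normal _ h1]

/-- The covector `⟨ν, ·⟩` of a unit normal field is a nonzero multiple of the normal covector. -/
theorem IsUnitNormalOn.exists_smul_normalCovector (hν : IsUnitNormalOn g f ν W) (hW : IsOpen W)
    (he : e ∈ IsManifold.maximalAtlas (𝓡 2) ∞ S) (hφ : φ ∈ IsManifold.maximalAtlas (𝓡 3) ∞ M)
    (hf : ContMDiff (𝓡 2) (𝓡 3) ∞ f)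
    (hinj : ∀ q, Function.Injective (mfderiv (𝓡 2) (𝓡 3) f q))
    (hx : x ∈ localRepDomain φ f e) (hxW : e.symm x ∈ W) :
    ∃ c : ℝ, c ≠ 0 ∧ ∀ l, ∑ k, metricCoeff g φ (localRep φ f e x) k l * fieldRep φ e ν x k
      = c * normalCovector (localRep φ f e) x l := by
  have hn := (hν.eventually_normal hW he hφ hf hx hxW).self_of_nhds
  simp only [pairing_eq_sum] at hn
  obtain ⟨c, hc⟩ := exists_eq_smul_cross (normalCovector_localRep_ne_zero he hφ hf hinj hx)
    (hn 0) (hn 1)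
  refine ⟨c, fun h0 ↦ ?_, hc⟩
  obtain ⟨ε, hε, hεe⟩ := hν.exists_sign hW he hφ hf hx hxW
  apply hε
  rw [← hεe.self_of_nhds, pairing_eq_sum]
  simp [hc, h0]

theorem components_covDerivAlong (hν : IsUnitNormalOn g f ν W) (hW : IsOpen W)
    (he : e ∈ IsManifold.maximalAtlas (𝓡 2) ∞ S) (hφ : φ ∈ IsManifold.maximalAtlas (𝓡 3) ∞ M)
    (hf : ContMDiff (𝓡 2) (𝓡 3) ∞ f) (hx : x ∈ localRepDomain φ f e) (hxW : e.symm x ∈ W)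
    (i : Fin 2) :
    (components φ (f (e.symm x)) (covDerivAlong g f φ ν (e.symm x) (coordVec e i x)) : Fin 3 → ℝ)
      = covDerivCoord (metricCoeff g φ) (localRep φ f e) (fieldRep φ e ν) i x := by
  have h1 : ∀ k, covDerivComponent g f φ ν (e.symm x) (coordVec e i x) k
      = covDerivCoord (metricCoeff g φ) (localRep φ f e) (fieldRep φ e ν) i x k := by
    intro k
    rw [covDerivComponent, dirDeriv_coordVec he hx.1
      ((hν.contMDiffAt_component hW hφ hxW hx.2 k).mdifferentiableAt (by simp)),
      components_mfderiv_coordVec he hφ hf hx]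
    rfl
  have h2 : covDerivAlong g f φ ν (e.symm x) (coordVec e i x)
      = (chartSymmDeriv φ (φ (f (e.symm x))) (WithLp.toLp 2 fun k ↦
        covDerivCoord (metricCoeff g φ) (localRep φ f e) (fieldRep φ e ν) i x k) :
          EuclideanSpace ℝ (Fin 3)) := by
    rw [← sum_smul_coordVec, covDerivAlong]
    simp only [h1]
    rfl
  rw [h2, components_chartSymmDeriv hφ hx.2]

/-- The matrix of a shape operator in the coordinate basis satisfies the Weingarten equations. -/
theorem IsShapeOperator.exists_matrix (he : e ∈ IsManifold.maximalAtlas (𝓡 2) ∞ S)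
    (hφ : φ ∈ IsManifold.maximalAtlas (𝓡 3) ∞ M) (hf : ContMDiff (𝓡 2) (𝓡 3) ∞ f)
    (hinj : ∀ q, Function.Injective (mfderiv (𝓡 2) (𝓡 3) f q)) (hx : x ∈ localRepDomain φ f e)
    {A : TangentSpace (𝓡 2) (e.symm x) →ₗ[ℝ] TangentSpace (𝓡 2) (e.symm x)}
    (hA : IsShapeOperator g f φ (e.symm x) A) :
    ∃ (a : Matrix (Fin 2) (Fin 2) ℝ) (c : ℝ), c ≠ 0 ∧
      (∀ i, A (coordVec e i x) = ∑ k, a k i • coordVec e k x) ∧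
      a.transpose * firstFFCoeff g f e x
        = c • secondFormCoord (metricCoeff g φ) (localRep φ f e) x := by
  obtain ⟨-, -, ν, W, hW, hxW, hν, hAν⟩ := hA
  obtain ⟨c, hc0, hc⟩ := hν.exists_smul_normalCovector hW he hφ hf hinj hx hxW
  refine ⟨Matrix.of fun k i ↦ chartDeriv e (e.symm x) (A (coordVec e i x)) k, c, hc0,
    fun i ↦ eq_sum_smul_coordVec he hx.1 _, ?_⟩
  ext i j
  have h1 : firstFF g f (e.symm x) (A (coordVec e i x)) (coordVec e j x)
      = c * secondFormCoord (metricCoeff g φ) (localRep φ f e) x i j := by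
    rw [firstFF, hAν, map_neg, neg_apply, inner_eq_pairing hφ hx.2,
      components_covDerivAlong hν hW he hφ hf hx hxW, components_mfderiv_coordVec he hφ hf hx]
    rw [neg_eq_iff_eq_neg]
    exact pairing_covDerivCoord_normal (contDiffAt_localRep he hφ hf hx)
      (contDiffAt_metricCoeff_localRep hφ hx) metricCoeff_isSymm
      (metricCoeff_det_ne_zero hφ (φ.map_source hx.2))
      (fun k ↦ (hν.contDiffAt_fieldRep hW he hφ hx hxW k).differentiableAt (by simp))
      (hν.eventually_normal hW he hφ hf hx hxW) hc i j
  rw [firstFF_eq_sum he hx.1, chartDeriv_coordVec he hx.1, pairing_eq_sum] at h1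
  rw [Matrix.mul_apply, Matrix.smul_apply, smul_eq_mul, ← h1]
  simp [PiLp.single_apply, mul_comm]

end NormalFields

section Existence

variable {S : Type*} [TopologicalSpace S] {M : Type*} [TopologicalSpace M]
  [ChartedSpace (EuclideanSpace ℝ (Fin 3)) M] [IsManifold (𝓡 3) ∞ M] {g : LorentzianMetric M}
  {f : S → M} {e : OpenPartialHomeomorph S (EuclideanSpace ℝ (Fin 2))}
  {φ : OpenPartialHomeomorph M (EuclideanSpace ℝ (Fin 3))}
  {x : EuclideanSpace ℝ (Fin 2)}

/-- The components of a normal vector field of `f`, obtained by raising the index of the normal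
covector with the adjugate of the metric instead of its inverse. -/
def normalVector (g : LorentzianMetric M) (φ : OpenPartialHomeomorph M (EuclideanSpace ℝ (Fin 3)))
    (f : S → M) (e : OpenPartialHomeomorph S (EuclideanSpace ℝ (Fin 2)))
    (y : EuclideanSpace ℝ (Fin 2)) (k : Fin 3) : ℝ :=
  ∑ l, (metricCoeff g φ (localRep φ f e y)).adjugate k l * normalCovector (localRep φ f e) y l

theorem sum_metricCoeff_mul_normalVector (l : Fin 3) :
    ∑ k, metricCoeff g φ (localRep φ f e x) k l * normalVector g φ f e x k
      = (metricCoeff g φ (localRep φ f e x)).det * normalCovector (localRep φ f e) x l := by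
  set A := metricCoeff g φ (localRep φ f e x) with hA
  have hs : A.IsSymm := metricCoeff_isSymm _
  have h1 : ∀ m, ∑ k, A k l * A.adjugate k m = if l = m then A.det else 0 := by
    intro m
    have := congrFun (congrFun (Matrix.mul_adjugate A) l) m
    rw [Matrix.mul_apply, Matrix.smul_apply, Matrix.one_apply] at this
    simp only [smul_eq_mul, mul_ite, mul_one, mul_zero] at this
    rw [← this]
    exact Finset.sum_congr rfl fun k _ ↦ by rw [hs.apply]
  simp only [normalVector, ← hA, Finset.mul_sum]
  rw [Finset.sum_comm]
  simp only [← mul_assoc, ← Finset.sum_mul, h1]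
  simp

variable [ChartedSpace (EuclideanSpace ℝ (Fin 2)) S]

/-- As `⟨N, N⟩ = det(g) λ` for `N = normalVector`, the vector `N` is null precisely at the lightlike
points. -/
theorem pairing_normalVector_self (he : e ∈ IsManifold.maximalAtlas (𝓡 2) ∞ S)
    (hφ : φ ∈ IsManifold.maximalAtlas (𝓡 3) ∞ M) (hf : ContMDiff (𝓡 2) (𝓡 3) ∞ f)
    (hx : x ∈ localRepDomain φ f e) :
    pairing (metricCoeff g φ (localRep φ f e x)) (normalVector g φ f e x)
        (normalVector g φ f e x)
      = (metricCoeff g φ (localRep φ f e x)).det * (firstFFCoeff g f e x).det := by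
  rw [pairing_eq_sum]
  simp only [sum_metricCoeff_mul_normalVector]
  rw [Matrix.det_fin_two]
  simp only [firstFFCoeff_eq_pairing he hφ hf hx]
  rw [← pairing_adjugate_cross (metricCoeff_isSymm _), pairing, Finset.mul_sum]
  refine Finset.sum_congr rfl fun k _ ↦ ?_
  rw [normalVector, Finset.mul_sum, Finset.mul_sum]
  refine Finset.sum_congr rfl fun l _ ↦ ?_
  rw [normalCovector]
  ring

theorem contDiffAt_normalVector (he : e ∈ IsManifold.maximalAtlas (𝓡 2) ∞ S)
    (hφ : φ ∈ IsManifold.maximalAtlas (𝓡 3) ∞ M) (hf : ContMDiff (𝓡 2) (𝓡 3) ∞ f)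
    (hx : x ∈ localRepDomain φ f e) (k : Fin 3) :
    ContDiffAt ℝ ∞ (fun y ↦ normalVector g φ f e y k) x := by
  have hF := contDiffAt_localRep he hφ hf hx
  exact ContDiffAt.sum fun l _ ↦ ((ContDiffAt.matrix_adjugate
    (contDiffAt_metricCoeff_localRep (g := g) hφ hx) k l).comp x hF).mul (hF.normalCovector l)

/-- The components of the unit normal field obtained by normalising `normalVector`. -/
def unitNormalVector (g : LorentzianMetric M)
    (φ : OpenPartialHomeomorph M (EuclideanSpace ℝ (Fin 3)))
    (f : S → M) (e : OpenPartialHomeomorph S (EuclideanSpace ℝ (Fin 2)))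
    (y : EuclideanSpace ℝ (Fin 2)) : EuclideanSpace ℝ (Fin 3) :=
  WithLp.toLp 2 fun k ↦ (√|pairing (metricCoeff g φ (localRep φ f e y)) (normalVector g φ f e y)
    (normalVector g φ f e y)|)⁻¹ * normalVector g φ f e y k

/-- The coordinates in `localRepDomain` of the points that are not lightlike. -/
def nonlightlikeDomain (g : LorentzianMetric M)
    (φ : OpenPartialHomeomorph M (EuclideanSpace ℝ (Fin 3)))
    (f : S → M) (e : OpenPartialHomeomorph S (EuclideanSpace ℝ (Fin 2))) :
    Set (EuclideanSpace ℝ (Fin 2)) :=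
  localRepDomain φ f e ∩ {y | (firstFFCoeff g f e y).det ≠ 0}

theorem isOpen_nonlightlikeDomain (he : e ∈ IsManifold.maximalAtlas (𝓡 2) ∞ S)
    (hφ : φ ∈ IsManifold.maximalAtlas (𝓡 3) ∞ M) (hf : ContMDiff (𝓡 2) (𝓡 3) ∞ f) :
    IsOpen (nonlightlikeDomain g φ f e) := by
  refine ContinuousOn.isOpen_inter_preimage (fun y hy ↦ ?_)
    (isOpen_localRepDomain hf.continuous) isOpen_compl_singleton
  exact (ContDiffAt.matrix_det
    (contDiffAt_firstFFCoeff he hφ hf hy)).continuousAt.continuousWithinAt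

theorem pairing_normalVector_ne_zero (he : e ∈ IsManifold.maximalAtlas (𝓡 2) ∞ S)
    (hφ : φ ∈ IsManifold.maximalAtlas (𝓡 3) ∞ M) (hf : ContMDiff (𝓡 2) (𝓡 3) ∞ f)
    (hx : x ∈ nonlightlikeDomain g φ f e) :
    pairing (metricCoeff g φ (localRep φ f e x)) (normalVector g φ f e x)
        (normalVector g φ f e x) ≠ 0 := by
  rw [pairing_normalVector_self he hφ hf hx.1]
  exact mul_ne_zero (metricCoeff_det_ne_zero hφ (φ.map_source hx.1.2)) hx.2

theorem contDiffAt_unitNormalVector (he : e ∈ IsManifold.maximalAtlas (𝓡 2) ∞ S)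
    (hφ : φ ∈ IsManifold.maximalAtlas (𝓡 3) ∞ M) (hf : ContMDiff (𝓡 2) (𝓡 3) ∞ f)
    (hx : x ∈ nonlightlikeDomain g φ f e) :
    ContDiffAt ℝ ∞ (unitNormalVector g φ f e) x := by
  have hN := contDiffAt_normalVector (g := g) he hφ hf hx.1
  have hne := pairing_normalVector_ne_zero he hφ hf hx
  have hP := contDiffAt_pairing (fun k l ↦
    (contDiffAt_metricCoeff_localRep (g := g) hφ hx.1 k l).comp x
      (contDiffAt_localRep he hφ hf hx.1)) hN hN
  refine contDiffAt_piLp _ |>.2 fun k ↦ ?_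
  exact (((hP.abs hne).sqrt (abs_ne_zero.2 hne)).inv
    (Real.sqrt_ne_zero'.2 (abs_pos.2 hne))).mul (hN k)

/-- Off the lightlike points, a surface has local unit normal fields. -/
theorem exists_isUnitNormalOn (he : e ∈ IsManifold.maximalAtlas (𝓡 2) ∞ S)
    (hφ : φ ∈ IsManifold.maximalAtlas (𝓡 3) ∞ M) (hf : ContMDiff (𝓡 2) (𝓡 3) ∞ f)
    (hx : x ∈ nonlightlikeDomain g φ f e) :
    ∃ (ν : ∀ q : S, TangentSpace (𝓡 3) (f q)) (W : Set S), IsOpen W ∧ e.symm x ∈ W ∧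
      IsUnitNormalOn g f ν W := by
  set u := unitNormalVector g φ f e with hu
  let ν : ∀ q : S, TangentSpace (𝓡 3) (f q) := fun q ↦
    (chartSymmDeriv φ (φ (f q)) (u (e q)) : EuclideanSpace ℝ (Fin 3))
  have hνu : ∀ y ∈ localRepDomain φ f e, fieldRep φ e ν y = u y := by
    intro y hy
    have := components_chartSymmDeriv hφ hy.2 (u (e (e.symm y)))
    rw [e.right_inv hy.1] at this
    funext k
    rw [← this]
    rw [fieldRep]
    conv_lhs => rw [show ν (e.symm y) = (chartSymmDeriv φ (φ (f (e.symm y))) (u (e (e.symm y))) :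
      EuclideanSpace ℝ (Fin 3)) from rfl, e.right_inv hy.1]
  refine ⟨ν, e.source ∩ e ⁻¹' nonlightlikeDomain g φ f e,
    e.isOpen_inter_preimage (isOpen_nonlightlikeDomain he hφ hf),
    ⟨e.map_target hx.1.1, by simpa [e.right_inv hx.1.1] using hx⟩, ?_, ?_, ?_⟩
  · intro q hq
    have hqφ : f q ∈ φ.source := by
      have := hq.2.1.2
      rwa [mem_preimage, mem_preimage, e.left_inv hq.1] at this
    have hc : ContMDiffAt (𝓡 2) (𝓡 3) ∞ (fun q' ↦ φ (f q')) q :=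
      (contMDiffAt_of_mem_maximalAtlas hφ hqφ).comp q hf.contMDiffAt
    have hu' : ContMDiffAt (𝓡 2) (𝓡 3) ∞ (fun q' ↦ u (e q')) q :=
      (contDiffAt_unitNormalVector he hφ hf hq.2).contMDiffAt.comp q
        (contMDiffAt_of_mem_maximalAtlas he hq.1)
    refine ContMDiffAt.contMDiffWithinAt ?_
    refine (contMDiffAt_coordVec hφ hc hu' (φ.map_source hqφ)).congr_of_eventuallyEq ?_
    filter_upwards [hf.continuous.continuousAt.preimage_mem_nhds
      (φ.open_source.mem_nhds hqφ)] with q' hq'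
    -- the base points `φ⁻¹(φ(f q'))` and `f q'` agree only propositionally
    have key : ∀ (m m' : M) (_ : m = m') (v : EuclideanSpace ℝ (Fin 3)),
        (⟨m, v⟩ : TangentBundle (𝓡 3) M) = ⟨m', v⟩ := by
      rintro m m' rfl v
      rfl
    exact key _ _ (φ.left_inv hq').symm _
  · rintro q ⟨hq, hqx⟩ v
    obtain ⟨y, hy, rfl⟩ : ∃ y ∈ e.target, e.symm y = q := ⟨e q, e.map_source hq, e.left_inv hq⟩
    rw [mem_preimage, e.right_inv hy] at hqx
    rw [eq_sum_smul_coordVec he hy v]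
    simp only [map_sum, map_smul]
    refine Finset.sum_eq_zero fun j _ ↦ ?_
    rw [← pairing_fieldRep_tangentCoord he hφ hf hqx.1, hνu y hqx.1, pairing_eq_sum]
    have h1 : ∀ l, ∑ k, metricCoeff g φ (localRep φ f e y) k l * u y k
        = (√|pairing (metricCoeff g φ (localRep φ f e y)) (normalVector g φ f e y)
          (normalVector g φ f e y)|)⁻¹ * ((metricCoeff g φ (localRep φ f e y)).det
            * normalCovector (localRep φ f e) y l) := by
      intro l
      rw [← sum_metricCoeff_mul_normalVector, Finset.mul_sum]
      refine Finset.sum_congr rfl fun k _ ↦ ?_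
      simp only [hu, unitNormalVector]
      ring
    have h2 : ∑ l, normalCovector (localRep φ f e) y l * tangentCoord (localRep φ f e) j y l
        = 0 := by
      fin_cases j
      · exact sum_cross_mul_left _ _
      · exact sum_cross_mul_right _ _
    simp only [h1, mul_assoc, ← Finset.mul_sum, h2]
    simp
  · rintro q ⟨hq, hqx⟩
    obtain ⟨y, hy, rfl⟩ : ∃ y ∈ e.target, e.symm y = q := ⟨e q, e.map_source hq, e.left_inv hq⟩
    rw [mem_preimage, e.right_inv hy] at hqx
    have hne := abs_pos.2 (pairing_normalVector_ne_zero he hφ hf hqx)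
    rw [inner_eq_pairing hφ hqx.1.2]
    change |pairing (metricCoeff g φ (localRep φ f e y)) (fieldRep φ e ν y) (fieldRep φ e ν y)| = 1
    rw [hνu y hqx.1]
    have h1 : ∀ (A : Matrix (Fin 3) (Fin 3) ℝ) (s : ℝ) (v : Fin 3 → ℝ),
        pairing A (fun k ↦ s * v k) (fun k ↦ s * v k) = s ^ 2 * pairing A v v := by
      intro A s v
      simp only [pairing, Finset.mul_sum]
      exact Finset.sum_congr rfl fun k _ ↦ Finset.sum_congr rfl fun l _ ↦ by ring
    simp only [hu, unitNormalVector]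
    rw [h1, abs_mul, abs_of_nonneg (sq_nonneg _), inv_pow, Real.sq_sqrt hne.le]
    exact inv_mul_cancel₀ hne.ne'

theorem covDerivComponent_add (ν : ∀ q : S, TangentSpace (𝓡 3) (f q)) (q : S)
    (v w : TangentSpace (𝓡 2) q) (k : Fin 3) :
    covDerivComponent g f φ ν q (v + w) k
      = covDerivComponent g f φ ν q v k + covDerivComponent g f φ ν q w k := by
  have h1 : dirDeriv (fun q' ↦ components φ (f q') (ν q') k) q (v + w)
      = dirDeriv (fun q' ↦ components φ (f q') (ν q') k) q v
        + dirDeriv (fun q' ↦ components φ (f q') (ν q') k) q w := map_add _ v w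
  have h2 : ∀ i, components φ (f q) (mfderiv (𝓡 2) (𝓡 3) f q (v + w)) i
      = components φ (f q) (mfderiv (𝓡 2) (𝓡 3) f q v) i
        + components φ (f q) (mfderiv (𝓡 2) (𝓡 3) f q w) i := fun i ↦ by
    rw [map_add, components, map_add]
    rfl
  simp only [covDerivComponent, h1, h2, mul_add, add_mul, Finset.sum_add_distrib]
  ring

theorem covDerivComponent_smul (ν : ∀ q : S, TangentSpace (𝓡 3) (f q)) (q : S)
    (c : ℝ) (v : TangentSpace (𝓡 2) q) (k : Fin 3) :
    covDerivComponent g f φ ν q (c • v) k = c * covDerivComponent g f φ ν q v k := by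
  have h1 : dirDeriv (fun q' ↦ components φ (f q') (ν q') k) q (c • v)
      = c * dirDeriv (fun q' ↦ components φ (f q') (ν q') k) q v := map_smul _ c v
  have h2 : ∀ i, components φ (f q) (mfderiv (𝓡 2) (𝓡 3) f q (c • v)) i
      = c * components φ (f q) (mfderiv (𝓡 2) (𝓡 3) f q v) i := fun i ↦ by
    rw [map_smul, components, map_smul]
    rfl
  simp only [covDerivComponent, h1, h2, mul_add, Finset.mul_sum]
  congr 1
  exact Finset.sum_congr rfl fun a _ ↦ Finset.sum_congr rfl fun b _ ↦ by ring

/-- `∇ν` as a linear map on the tangent space. -/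
def covDerivLinear (g : LorentzianMetric M) (f : S → M)
    (φ : OpenPartialHomeomorph M (EuclideanSpace ℝ (Fin 3)))
    (ν : ∀ q : S, TangentSpace (𝓡 3) (f q)) (q : S) :
    TangentSpace (𝓡 2) q →ₗ[ℝ] TangentSpace (𝓡 3) (f q) where
  toFun v := covDerivAlong g f φ ν q v
  map_add' v w := by
    change (∑ k, covDerivComponent g f φ ν q (v + w) k
        • (coordVec φ k (φ (f q)) : EuclideanSpace ℝ (Fin 3)))
      = (∑ k, covDerivComponent g f φ ν q v k
          • (coordVec φ k (φ (f q)) : EuclideanSpace ℝ (Fin 3)))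
        + ∑ k, covDerivComponent g f φ ν q w k
          • (coordVec φ k (φ (f q)) : EuclideanSpace ℝ (Fin 3))
    simp only [covDerivComponent_add, add_smul, Finset.sum_add_distrib]
  map_smul' c v := by
    change (∑ k, covDerivComponent g f φ ν q (c • v) k
        • (coordVec φ k (φ (f q)) : EuclideanSpace ℝ (Fin 3)))
      = c • ∑ k, covDerivComponent g f φ ν q v k
          • (coordVec φ k (φ (f q)) : EuclideanSpace ℝ (Fin 3))
    simp only [covDerivComponent_smul, mul_smul, Finset.smul_sum]

/-- Off the lightlike points a shape operator exists, because `∇ν` is tangent to the surface. -/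
theorem exists_isShapeOperator (he : e ∈ IsManifold.maximalAtlas (𝓡 2) ∞ S)
    (hφ : φ ∈ IsManifold.maximalAtlas (𝓡 3) ∞ M) (hf : ContMDiff (𝓡 2) (𝓡 3) ∞ f)
    (hinj : ∀ q, Function.Injective (mfderiv (𝓡 2) (𝓡 3) f q))
    (hx : x ∈ nonlightlikeDomain g φ f e) :
    ∃ A : TangentSpace (𝓡 2) (e.symm x) →ₗ[ℝ] TangentSpace (𝓡 2) (e.symm x),
      IsShapeOperator g f φ (e.symm x) A := by
  obtain ⟨ν, W, hW, hxW, hν⟩ := exists_isUnitNormalOn he hφ hf hx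
  obtain ⟨c, hc0, hc⟩ := hν.exists_smul_normalCovector hW he hφ hf hinj hx.1 hxW
  obtain ⟨ε, hε, hεe⟩ := hν.exists_sign hW he hφ hf hx.1 hxW
  -- `∇ν` is orthogonal to `ν`, so it lies in the kernel of `n`, which is the tangent plane
  have htan : ∀ i, ∃ w : TangentSpace (𝓡 2) (e.symm x), mfderiv (𝓡 2) (𝓡 3) f (e.symm x) w
      = covDerivAlong g f φ ν (e.symm x) (coordVec e i x) := by
    intro i
    have h1 := pairing_covDerivCoord_self (contDiffAt_localRep he hφ hf hx.1)
      (contDiffAt_metricCoeff_localRep hφ hx.1) metricCoeff_isSymm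
      (metricCoeff_det_ne_zero hφ (φ.map_source hx.1.2))
      (fun k ↦ (hν.contDiffAt_fieldRep hW he hφ hx.1 hxW k).differentiableAt (by simp)) hεe i
    rw [pairing_comm (metricCoeff_isSymm _), pairing_eq_sum] at h1
    simp only [hc, mul_assoc, ← Finset.mul_sum] at h1
    obtain ⟨s, t, hst⟩ := exists_eq_combination_of_cross
      (normalCovector_localRep_ne_zero he hφ hf hinj hx.1) ((mul_eq_zero.1 h1).resolve_left hc0)
    refine ⟨s • coordVec e 0 x + t • coordVec e 1 x, components_injective hφ hx.1.2 ?_⟩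
    ext k
    rw [components_covDerivAlong hν hW he hφ hf hx.1 hxW, hst, map_add, map_smul, map_smul,
      ← components_mfderiv_coordVec he hφ hf hx.1, ← components_mfderiv_coordVec he hφ hf hx.1,
      components, map_add, map_smul, map_smul]
    rfl
  choose w hw using htan
  refine ⟨(coordBasis he hx.1.1).constr ℝ fun i ↦ -w i, hx.1.2,
    fun h ↦ hx.2 ((isLightlikePt_iff he hx.1.1).1 h), ν, W, hW, hxW, hν, fun v ↦ ?_⟩
  have hlin : (mfderiv (𝓡 2) (𝓡 3) f (e.symm x) : _ →ₗ[ℝ] _) ∘ₗ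
      (coordBasis he hx.1.1).constr ℝ (fun i ↦ -w i)
        = -covDerivLinear g f φ ν (e.symm x) := by
    refine (coordBasis he hx.1.1).ext fun i ↦ ?_
    rw [LinearMap.comp_apply, Module.Basis.constr_basis, coordBasis_apply]
    change mfderiv (𝓡 2) (𝓡 3) f (e.symm x) (-w i) = -covDerivAlong g f φ ν _ _
    rw [map_neg, hw]
  exact LinearMap.congr_fun hlin v

end Existence

/-! ### Umbilic points and principal curvatures near a lightlike point -/

section NearLightlikePoint

variable {S : Type*} [TopologicalSpace S] [ChartedSpace (EuclideanSpace ℝ (Fin 2)) S]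
  {M : Type*} [TopologicalSpace M] [ChartedSpace (EuclideanSpace ℝ (Fin 3)) M]
  [IsManifold (𝓡 3) ∞ M] {g : LorentzianMetric M}
  {f : S → M} {e : OpenPartialHomeomorph S (EuclideanSpace ℝ (Fin 2))}
  {φ : OpenPartialHomeomorph M (EuclideanSpace ℝ (Fin 3))}
  {x : EuclideanSpace ℝ (Fin 2)}

theorem eventually_umbilicDiscriminant_pos (he : e ∈ IsManifold.maximalAtlas (𝓡 2) ∞ S)
    (hφ : φ ∈ IsManifold.maximalAtlas (𝓡 3) ∞ M) (hf : ContMDiff (𝓡 2) (𝓡 3) ∞ f)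
    (hinj : ∀ q, Function.Injective (mfderiv (𝓡 2) (𝓡 3) f q)) (hx : x ∈ localRepDomain φ f e)
    (hlight : (firstFFCoeff g f e x).det = 0) (hd : fderiv ℝ (discriminant g f e) x ≠ 0) {C : ℝ}
    (hK : ∀ᶠ y in 𝓝 x, (firstFFCoeff g f e y).det ≠ 0 →
      |gaussCurvatureOfCoeff (firstFFCoeff g f e) y| ≤ C) :
    ∀ᶠ y in 𝓝 x, 0 < umbilicDiscriminant (firstFFCoeff g f e y)
      (secondFormCoord (metricCoeff g φ) (localRep φ f e) y) := by
  have hdom := (isOpen_localRepDomain (φ := φ) (e := e) hf.continuous).mem_nhds hx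
  have hF := contDiffAt_localRep he hφ hf hx
  have hG := contDiffAt_metricCoeff_localRep (g := g) hφ hx
  have hGd := metricCoeff_det_ne_zero (g := g) hφ (φ.map_source hx.2)
  refine (continuousAt_umbilicDiscriminant (contDiffAt_firstFFCoeff he hφ hf hx) hF hG
    hGd).eventually (lt_mem_nhds ?_)
  refine umbilicDiscriminant_pos ?_ ?_ firstFFCoeff_isSymm hF hG metricCoeff_isSymm hGd
    (normalCovector_localRep_ne_zero he hφ hf hinj hx) hlight hd hK
  · filter_upwards [hdom] with y hy i j using firstFFCoeff_eq_pairing he hφ hf hy i j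
  · filter_upwards [hdom] with y hy i j using contDiffAt_firstFFCoeff he hφ hf hy i j

theorem IsShapeOperator.exists_matrix_discriminant_pos
    (he : e ∈ IsManifold.maximalAtlas (𝓡 2) ∞ S)
    (hφ : φ ∈ IsManifold.maximalAtlas (𝓡 3) ∞ M) (hf : ContMDiff (𝓡 2) (𝓡 3) ∞ f)
    (hinj : ∀ q, Function.Injective (mfderiv (𝓡 2) (𝓡 3) f q)) (hx : x ∈ localRepDomain φ f e)
    (hpos : 0 < umbilicDiscriminant (firstFFCoeff g f e x)
      (secondFormCoord (metricCoeff g φ) (localRep φ f e) x))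
    {A : TangentSpace (𝓡 2) (e.symm x) →ₗ[ℝ] TangentSpace (𝓡 2) (e.symm x)}
    (hA : IsShapeOperator g f φ (e.symm x) A) :
    ∃ a : Matrix (Fin 2) (Fin 2) ℝ,
      (∀ i, A (coordBasis he hx.1 i) = ∑ k, a k i • coordBasis he hx.1 k) ∧
      0 < a.trace ^ 2 - 4 * a.det := by
  obtain ⟨a, c, hc, ha, haI⟩ := hA.exists_matrix he hφ hf hinj hx
  refine ⟨a, fun i ↦ by simpa only [coordBasis_apply] using ha i, ?_⟩
  have h1 := discriminant_mul_det_sq (firstFFCoeff_isSymm x) haI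
  have h2 : 0 < (a.trace ^ 2 - 4 * a.det) * (firstFFCoeff g f e x).det ^ 2 := by
    rw [h1]
    positivity
  exact pos_of_mul_pos_left h2 (sq_nonneg _)

end NearLightlikePoint

end

theorem mainTheorem9
    {S : Type*} [TopologicalSpace S] [ChartedSpace (EuclideanSpace ℝ (Fin 2)) S]
    [IsManifold (𝓡 2) ∞ S] [ConnectedSpace S]
    {M : Type*} [TopologicalSpace M] [ChartedSpace (EuclideanSpace ℝ (Fin 3)) M]
    [IsManifold (𝓡 3) ∞ M]
    (g : LorentzianMetric M) (f : S → M) (hf : IsMixedTypeSurface g f) (p : S)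
    -- arbitrary local coordinates of the surface around `p`
    (e : OpenPartialHomeomorph S (EuclideanSpace ℝ (Fin 2)))
    (he : e ∈ IsManifold.maximalAtlas (𝓡 2) ∞ S) (hpe : p ∈ e.source)
    -- arbitrary local coordinates of the ambient manifold around `f p`
    (φ : OpenPartialHomeomorph M (EuclideanSpace ℝ (Fin 3)))
    (hφ : φ ∈ IsManifold.maximalAtlas (𝓡 3) ∞ M) (hpφ : f p ∈ φ.source)
    (hp : IsNondegenerateLightlikePt g f e p)
    -- the Gaussian curvature is bounded on a neighbourhood of `p`
    (hK : ∃ U ∈ 𝓝 p, U ⊆ e.source ∧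
      ∃ C : ℝ, ∀ q ∈ U, ¬ IsLightlikePt g f q → |gaussCurvature g f e q| ≤ C) :
    (¬ AccPt p (𝓟 {q | IsUmbilicPt g f φ q})) ∧
      ∃ U : Set S, IsOpen U ∧ p ∈ U ∧
        ∀ q ∈ U, IsTimelikePt g f q → HasRealPrincipalCurvatures g f φ q := by
  obtain ⟨hlight, hdisc⟩ := hp
  obtain ⟨U, hU, hUe, C, hC⟩ := hK
  have hsm := hf.contMDiff
  have hinj := hf.injective_mfderiv
  obtain ⟨x, hx, rfl⟩ : ∃ x ∈ e.target, e.symm x = p := ⟨e p, e.map_source hpe, e.left_inv hpe⟩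
  rw [e.right_inv hx] at hdisc
  have hxd : x ∈ localRepDomain φ f e := ⟨hx, hpφ⟩
  have hK' : ∀ᶠ y in 𝓝 x, (firstFFCoeff g f e y).det ≠ 0 →
      |gaussCurvatureOfCoeff (firstFFCoeff g f e) y| ≤ C := by
    filter_upwards [(e.continuousAt_symm hx).preimage_mem_nhds hU,
      e.open_target.mem_nhds hx] with y hyU hy hne
    have := hC _ hyU fun h ↦ hne ((isLightlikePt_iff he hy).1 h)
    rwa [gaussCurvature, e.right_inv hy] at this
  have hev := eventually_umbilicDiscriminant_pos he hφ hsm hinj hxd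
    ((isLightlikePt_iff he hx).1 hlight) hdisc hK'
  obtain ⟨D, hD, hDo, hxD⟩ := eventually_nhds_iff.1
    (hev.and ((isOpen_localRepDomain hsm.continuous).mem_nhds hxd))
  -- all points of the open set `V` have coordinates at which the discriminant is positive
  set V := e.source ∩ e ⁻¹' D with hV
  have hVo : IsOpen V := e.isOpen_inter_preimage hDo
  have hpV : e.symm x ∈ V := ⟨e.map_target hx, by rwa [mem_preimage, e.right_inv hx]⟩
  have hVD : ∀ q ∈ V, ∃ y ∈ D, e.symm y = q := fun q hq ↦ ⟨e q, hq.2, e.left_inv hq.1⟩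
  refine ⟨fun hacc ↦ ?_, V, hVo, hpV, fun q hq ht ↦ ?_⟩
  · obtain ⟨q, ⟨hq, A, hA, k, hk⟩, -⟩ := accPt_iff_nhds.1 hacc V (hVo.mem_nhds hpV)
    obtain ⟨y, hyD, rfl⟩ := hVD q hq
    obtain ⟨a, ha, hapos⟩ :=
      hA.exists_matrix_discriminant_pos he hφ hsm hinj (hD y hyD).2 (hD y hyD).1
    exact hapos.ne' (discriminant_eq_zero_of_smul ha hk)
  · obtain ⟨y, hyD, rfl⟩ := hVD q hq
    obtain ⟨hpos, hyd⟩ := hD y hyD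
    obtain ⟨A, hA⟩ := exists_isShapeOperator he hφ hsm hinj
      (⟨hyd, (ht.det_neg he hyd.1).ne⟩ : y ∈ nonlightlikeDomain g φ f e)
    obtain ⟨a, ha, hapos⟩ := hA.exists_matrix_discriminant_pos he hφ hsm hinj hyd hpos
    exact ⟨A, hA, exists_eigenbasis_of_discriminant_pos ha hapos⟩
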